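/- **Definitions.** A $d$-dimensional vector addition system (VAS) is a finite set $\mathbf A\subseteq\mathbb Z^d$. A transition of $\mathbf A$ is a triple $(\mathbf u,\mathbf a,\mathbf v)\in\mathbb N^d\times\mathbf A\times\mathbb N^d$ with $\mathbf v=\mathbf u+\mathbf a$; the set of transitions is $\mathrm{Trans}_{\mathbf A}$. A prerun over $\mathbf A$ is an element $(\mathbf u,w,\mathbf v)$ of $\mathrm{PreRuns}_{\mathbf A}=\mathbb N^d\times(\mathbb N^d\times\mathbf A\times\mathbb N^d)^*\times\mathbb N^d$. It is a run from $\mathbf u$ to $\mathbf v$ if $w$ is a sequence of transitions such that either $w=\varepsilon$ and $\mathbf u=\mathbf v$, or the first transition of $w$ starts in $\mathbf u$, the last one ends in $\mathbf v$, and each other transition starts where the previous one ends. Let $\mathrm{Runs}_{\mathbf A}(\mathbf x,\mathbf y)$ be the set of runs from $\mathbf x$ to $\mathbf y$. Order $\mathbb N^d$ componentwise, $\mathbf A$ by equality, $\mathbb N^d\times\mathbf A\times\mathbb N^d$ by the product ordering, sequences of such triples by the sequence embedding ($w\le_* w'$ iff $w$ is pointwise below a subsequence of $w'$), and $\mathrm{PreRuns}_{\mathbf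 A}$ by the resulting product ordering $\unlhd$. An ideal is a non-empty directed downward-closed set. An ideal $I$ of an ordered set $X$ is in the adherence of $S\subseteq X$ if there is a directed set $\Delta\subseteq S$ with ${\downarrow}\Delta=I$. The ideals of $\mathrm{PreRuns}_{\mathbf A}$ are the sets ${\downarrow}\mathbf u\times P\times{\downarrow}\mathbf v$ with $\mathbf u,\mathbf v\in(\mathbb N\cup\{\omega\})^d$ and $P$ a finite concatenation of atoms, each of the form $E^*$ with $E\subseteq\mathbb N^d\times\mathbf A\times\mathbb N^d$ downward-closed, or $J\cup\{\varepsilon\}$ with $J$ an ideal of $\mathbb N^d\times\mathbf A\times\mathbb N^d$. Such an ideal $J$ is given by a triple in $(\mathbb N\cup\{\omega\})^d\times\mathbf A\times(\mathbb N\cup\{\omega\})^d$ of which it is the downward closure, and $E$ by a finite list of ideals with union $E$. **Problem (adherence membership of prerun ideals).** Input: a dimension $d$, a $d$-dimensional VAS $\mathbf A$, configurations $\mathbf x,\mathbf y\in\mathbb N^d$, and an ideal $I$ of $(\mathrm{PreRuns}_{\mathbf A},\unlhd)$, represented as above. Question: is $I$ in the adherence of $\mathrm{Runs}_{\mathbf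 A}(\mathbf x,\mathbf y)$? **Theorem.** Adherence membership of prerun ideals is undecidable. It is already undecidable when the inputs are restricted to those with $\mathbf y=\mathbf x$ whose ideal is given in the form ${\downarrow}\mathbf x\times({\downarrow}D)^*\times{\downarrow}\mathbf x$ for some $D\subseteq\mathrm{Trans}_{\mathbf A}$ that is downward-closed in $\mathrm{Trans}_{\mathbf A}$, where ${\downarrow}D$ is the downward closure of $D$ in $\mathbb N^d\times\mathbf A\times\mathbb N^d$: no algorithm halts with the correct answer on all these inputs. -/

import Mathlib

/-! ## Adherence -/

/-- The ideal `I` is in the adherence of `S`: there is a directed `Δ ⊆ S` with `↓Δ = I`. -/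
def IsAdherent {X : Type*} [Preorder X] (I : Order.Ideal X) (S : Set X) : Prop :=
  ∃ Δ ⊆ S, DirectedOn (· ≤ ·) Δ ∧ (lowerClosure Δ : Set X) = (I : Set X)

/-! ## Vector addition systems, preruns and runs -/

/-- A `d`-dimensional vector addition system: a finite set of actions in `ℤ^d`. -/
abbrev VAS (d : ℕ) : Type := Finset (Fin d → ℤ)

namespace VAS

variable {d : ℕ}

/-- An element `(u, a, v)` of `ℕ^d × A × ℕ^d`. -/
structure Triple (A : VAS d) where
  src : Fin d → ℕ
  act : {a : Fin d → ℤ // a ∈ A}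
  tgt : Fin d → ℕ

/-- The product ordering on `ℕ^d × A × ℕ^d`, where `A` is ordered by equality. -/
instance Triple.instPreorder (A : VAS d) : Preorder (Triple A) where
  le s t := s.src ≤ t.src ∧ s.act = t.act ∧ s.tgt ≤ t.tgt
  le_refl _ := ⟨le_rfl, rfl, le_rfl⟩
  le_trans _ _ _ h k := ⟨h.1.trans k.1, h.2.1.trans k.2.1, h.2.2.trans k.2.2⟩

/-- `(u, a, v)` is a transition if `v = u + a`. -/
def Triple.IsTransition {A : VAS d} (t : Triple A) : Prop :=
  ∀ i, (t.tgt i : ℤ) = (t.src i : ℤ) + t.act.1 i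

/-- The set of transitions of `A`. -/
def Trans (A : VAS d) : Set (Triple A) := {t | t.IsTransition}

/-- A prerun over `A`: an element of `ℕ^d × (ℕ^d × A × ℕ^d)^* × ℕ^d`. -/
structure Prerun (A : VAS d) where
  src : Fin d → ℕ
  word : List (Triple A)
  tgt : Fin d → ℕ

/-- The natural ordering of preruns: the product of the orderings of `ℕ^d` and of the sequence
embedding. -/
instance Prerun.instPreorder (A : VAS d) : Preorder (Prerun A) where
  le ρ τ := ρ.src ≤ τ.src ∧ List.SublistForall₂ (· ≤ ·) ρ.word τ.word ∧ ρ.tgt ≤ τ.tgt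
  le_refl ρ := ⟨le_rfl, List.SublistForall₂.is_refl.refl ρ.word, le_rfl⟩
  le_trans _ _ _ h k :=
    ⟨h.1.trans k.1, List.SublistForall₂.is_trans.trans _ _ _ h.2.1 k.2.1, h.2.2.trans k.2.2⟩

/-- `w` is a transition sequence leading from `u` to `v`, each transition starting where the
previous one ends. -/
def Connects {A : VAS d} : (Fin d → ℕ) → List (Triple A) → (Fin d → ℕ) → Prop
  | u, [], v => u = v
  | u, t :: w, v => t.src = u ∧ t.IsTransition ∧ Connects t.tgt w v

/-- A run is a connected prerun. -/
def Prerun.IsRun {A : VAS d} (ρ : Prerun A) : Prop := Connects ρ.src ρ.word ρ.tgt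

/-- The set of runs of `A` from `x` to `y`. -/
def Runs (A : VAS d) (x y : Fin d → ℕ) : Set (Prerun A) :=
  {ρ | ρ.IsRun ∧ ρ.src = x ∧ ρ.tgt = y}

/-! ## Representations of prerun ideals -/

/-- The vector `u ∈ ℕ^d`, seen in `ℕ_ω^d`. -/
def toOmega (u : Fin d → ℕ) : Fin d → ℕ∞ := fun i => (u i : ℕ∞)

/-- `↓r = {u ∈ ℕ^d | u ≤ r}`, for `r ∈ ℕ_ω^d`. -/
def downVec (r : Fin d → ℕ∞) : Set (Fin d → ℕ) := {u | toOmega u ≤ r}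

/-- An element `(u, a, v)` of `ℕ_ω^d × A × ℕ_ω^d`, which represents an ideal of
`ℕ^d × A × ℕ^d`. -/
structure OmegaTriple (A : VAS d) where
  src : Fin d → ℕ∞
  act : {a : Fin d → ℤ // a ∈ A}
  tgt : Fin d → ℕ∞

/-- The ideal `↓u × {a} × ↓v` of `ℕ^d × A × ℕ^d`. -/
def OmegaTriple.down {A : VAS d} (τ : OmegaTriple A) : Set (Triple A) :=
  {t | t.src ∈ downVec τ.src ∧ t.act = τ.act ∧ t.tgt ∈ downVec τ.tgt}

/-- The downward-closed subset of `ℕ^d × A × ℕ^d` represented by a finite list of ideals: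
their union. -/
def downList {A : VAS d} (L : List (OmegaTriple A)) : Set (Triple A) :=
  {t | ∃ τ ∈ L, t ∈ τ.down}

/-- Representations of atoms over `ℕ^d × A × ℕ^d`: `D^*`, where `D` is the union of a finite list
of ideals, or `I ∪ {ε}` for an ideal `I`. -/
inductive Atom (A : VAS d) where
  | star (L : List (OmegaTriple A))
  | opt (τ : OmegaTriple A)

/-- The language of an atom. -/
def Atom.lang {A : VAS d} : Atom A → Set (List (Triple A))
  | star L => {w | ∀ t ∈ w, t ∈ downList L}
  | opt τ => {w | w = [] ∨ ∃ t ∈ τ.down, w = [t]}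

/-- The language of a product `A₁ ⋯ A_k` of atoms. -/
def prodLang {A : VAS d} : List (Atom A) → Set (List (Triple A))
  | [] => {[]}
  | a :: P => {w | ∃ w₁ ∈ a.lang, ∃ w₂ ∈ prodLang P, w = w₁ ++ w₂}

/-- A representation of a prerun ideal `↓u × P × ↓v`, with `u, v ∈ ℕ_ω^d` and `P` a product. -/
structure IdealRep (A : VAS d) where
  src : Fin d → ℕ∞
  word : List (Atom A)
  tgt : Fin d → ℕ∞

/-- The set of preruns `↓u × P × ↓v`. -/
def IdealRep.toSet {A : VAS d} (I : IdealRep A) : Set (Prerun A) :=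
  {ρ | ρ.src ∈ downVec I.src ∧ ρ.word ∈ prodLang I.word ∧ ρ.tgt ∈ downVec I.tgt}

/-! ### The represented sets are ideals -/

theorem zero_mem_downVec (r : Fin d → ℕ∞) : (0 : Fin d → ℕ) ∈ downVec r := by
  intro i; simp [toOmega]

theorem downVec_mono {r : Fin d → ℕ∞} {u v : Fin d → ℕ} (h : u ≤ v) (hv : v ∈ downVec r) :
    u ∈ downVec r :=
  fun i => le_trans (by simpa [toOmega] using h i) (hv i)

theorem sup_mem_downVec {r : Fin d → ℕ∞} {u v : Fin d → ℕ} (hu : u ∈ downVec r)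
    (hv : v ∈ downVec r) : u ⊔ v ∈ downVec r := by
  intro i
  rcases le_total (u i) (v i) with h | h
  · have := hv i; simpa [toOmega, h] using this
  · have := hu i; simpa [toOmega, h] using this

theorem OmegaTriple.down_mono {A : VAS d} {τ : OmegaTriple A} {s t : Triple A} (h : s ≤ t)
    (ht : t ∈ τ.down) : s ∈ τ.down :=
  ⟨downVec_mono h.1 ht.1, h.2.1.trans ht.2.1, downVec_mono h.2.2 ht.2.2⟩

section Embedding

variable {α : Type*} [Preorder α]

theorem embed_append {a b c e : List α} (h : List.SublistForall₂ (· ≤ ·) a b)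
    (k : List.SublistForall₂ (· ≤ ·) c e) :
    List.SublistForall₂ (· ≤ ·) (a ++ c) (b ++ e) := by
  induction h with
  | nil =>
    rename_i l
    induction l with
    | nil => exact k
    | cons x l ih => exact .cons_right ih
  | cons h _ ih => exact .cons h ih
  | cons_right _ ih => exact .cons_right ih

theorem embed_split {w b c : List α} (h : List.SublistForall₂ (· ≤ ·) w (b ++ c)) :
    ∃ w₁ w₂, w = w₁ ++ w₂ ∧ List.SublistForall₂ (· ≤ ·) w₁ b ∧
      List.SublistForall₂ (· ≤ ·) w₂ c := by
  induction b generalizing w with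
  | nil => exact ⟨[], w, rfl, .nil, h⟩
  | cons x b ih =>
    cases h with
    | nil => exact ⟨[], [], rfl, .nil, .nil⟩
    | cons h k =>
      obtain ⟨w₁, w₂, rfl, h₁, h₂⟩ := ih k
      exact ⟨_ :: w₁, w₂, rfl, .cons h h₁, h₂⟩
    | cons_right k =>
      obtain ⟨w₁, w₂, rfl, h₁, h₂⟩ := ih k
      exact ⟨w₁, w₂, rfl, .cons_right h₁, h₂⟩

theorem embed_mem {w w' : List α} (h : List.SublistForall₂ (· ≤ ·) w w') :
    ∀ t ∈ w, ∃ t' ∈ w', t ≤ t' := by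
  induction h with
  | nil => simp
  | cons h _ ih =>
    intro t ht
    rcases List.mem_cons.1 ht with rfl | ht
    · exact ⟨_, List.mem_cons_self, h⟩
    · obtain ⟨t', h₁, h₂⟩ := ih t ht
      exact ⟨t', List.mem_cons_of_mem _ h₁, h₂⟩
  | cons_right _ ih =>
    intro t ht
    obtain ⟨t', h₁, h₂⟩ := ih t ht
    exact ⟨t', List.mem_cons_of_mem _ h₁, h₂⟩

end Embedding

theorem Atom.lang_lower {A : VAS d} (a : Atom A) {w w' : List (Triple A)}
    (h : List.SublistForall₂ (· ≤ ·) w w') (hw : w' ∈ a.lang) : w ∈ a.lang := by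
  cases a with
  | star L =>
    intro t ht
    obtain ⟨t', h₁, h₂⟩ := embed_mem h t ht
    obtain ⟨τ, hτ, h₃⟩ := hw t' h₁
    exact ⟨τ, hτ, τ.down_mono h₂ h₃⟩
  | opt τ =>
    rcases hw with rfl | ⟨t, ht, rfl⟩
    · cases h; exact Or.inl rfl
    · cases h with
      | nil => exact Or.inl rfl
      | cons h k => cases k; exact Or.inr ⟨_, τ.down_mono h ht, rfl⟩
      | cons_right k => cases k; exact Or.inl rfl

theorem Atom.nil_mem_lang {A : VAS d} (a : Atom A) : [] ∈ a.lang := by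
  cases a with
  | star L => intro t ht; simp at ht
  | opt τ => exact Or.inl rfl

theorem Atom.lang_directed {A : VAS d} (a : Atom A) :
    DirectedOn (List.SublistForall₂ (· ≤ ·)) a.lang := by
  have hr : ∀ w : List (Triple A), List.SublistForall₂ (· ≤ ·) w w :=
    List.SublistForall₂.is_refl.refl
  cases a with
  | star L =>
    intro w hw w' hw'
    refine ⟨w ++ w', ?_, ?_, ?_⟩
    · intro t ht
      rcases List.mem_append.1 ht with ht | ht
      exacts [hw t ht, hw' t ht]
    · simpa using embed_append (hr w) (.nil : List.SublistForall₂ (· ≤ ·) [] w')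
    · simpa using embed_append (.nil : List.SublistForall₂ (· ≤ ·) [] w) (hr w')
  | opt τ =>
    rintro w (rfl | ⟨t, ht, rfl⟩) w' hw'
    · exact ⟨w', hw', .nil, hr _⟩
    · rcases hw' with rfl | ⟨t', ht', rfl⟩
      · exact ⟨[t], Or.inr ⟨t, ht, rfl⟩, hr _, .nil⟩
      · refine ⟨[⟨t.src ⊔ t'.src, τ.act, t.tgt ⊔ t'.tgt⟩],
          Or.inr ⟨_, ⟨sup_mem_downVec ht.1 ht'.1, rfl, sup_mem_downVec ht.2.2 ht'.2.2⟩, rfl⟩,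
          .cons ⟨le_sup_left, ht.2.1, le_sup_left⟩ .nil,
          .cons ⟨le_sup_right, ht'.2.1, le_sup_right⟩ .nil⟩

theorem nil_mem_prodLang {A : VAS d} (P : List (Atom A)) : [] ∈ prodLang P := by
  induction P with
  | nil => rfl
  | cons a P ih => exact ⟨[], a.nil_mem_lang, [], ih, rfl⟩

theorem prodLang_lower {A : VAS d} (P : List (Atom A)) {w w' : List (Triple A)}
    (h : List.SublistForall₂ (· ≤ ·) w w') (hw : w' ∈ prodLang P) : w ∈ prodLang P := by
  induction P generalizing w w' with
  | nil => obtain rfl : w' = [] := hw; cases h; rfl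
  | cons a P ih =>
    obtain ⟨u, hu, v, hv, rfl⟩ := hw
    obtain ⟨w₁, w₂, rfl, h₁, h₂⟩ := embed_split h
    exact ⟨w₁, a.lang_lower h₁ hu, w₂, ih h₂ hv, rfl⟩

theorem prodLang_directed {A : VAS d} (P : List (Atom A)) :
    DirectedOn (List.SublistForall₂ (· ≤ ·)) (prodLang P) := by
  induction P with
  | nil => rintro w rfl w' rfl; exact ⟨[], rfl, .nil, .nil⟩
  | cons a P ih =>
    rintro _ ⟨u, hu, v, hv, rfl⟩ _ ⟨u', hu', v', hv', rfl⟩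
    obtain ⟨x, hx, h₁, h₂⟩ := a.lang_directed u hu u' hu'
    obtain ⟨y, hy, h₃, h₄⟩ := ih v hv v' hv'
    exact ⟨x ++ y, ⟨x, hx, y, hy, rfl⟩, embed_append h₁ h₃, embed_append h₂ h₄⟩

theorem IdealRep.isIdeal {A : VAS d} (I : IdealRep A) : Order.IsIdeal I.toSet where
  IsLowerSet := fun _ _ h k =>
    ⟨downVec_mono h.1 k.1, prodLang_lower _ h.2.1 k.2.1, downVec_mono h.2.2 k.2.2⟩
  Nonempty := ⟨⟨0, [], 0⟩, zero_mem_downVec _, nil_mem_prodLang _, zero_mem_downVec _⟩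
  Directed := by
    intro ρ h τ k
    obtain ⟨w, hw, h₁, h₂⟩ := prodLang_directed I.word _ h.2.1 _ k.2.1
    exact ⟨⟨ρ.src ⊔ τ.src, w, ρ.tgt ⊔ τ.tgt⟩,
      ⟨sup_mem_downVec h.1 k.1, hw, sup_mem_downVec h.2.2 k.2.2⟩,
      ⟨le_sup_left, h₁, le_sup_left⟩, ⟨le_sup_right, h₂, le_sup_right⟩⟩

/-- The ideal `↓u × P × ↓v` of the set of preruns. -/
def IdealRep.toIdeal {A : VAS d} (I : IdealRep A) : Order.Ideal (Prerun A) := I.isIdeal.toIdeal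

/-! ## The decision problem -/

/-- An input of the adherence membership problem: a `d`-dimensional VAS, given by a list of its
actions, two configurations and a prerun ideal. -/
structure AdhInput where
  d : ℕ
  actions : List (Fin d → ℤ)
  x : Fin d → ℕ
  y : Fin d → ℕ
  ideal : IdealRep actions.toFinset

/-- The question of the adherence membership problem: is the ideal in the adherence of the set of
runs from `x` to `y`? -/
def AdhInput.IsPositive (p : AdhInput) : Prop :=
  IsAdherent p.ideal.toIdeal (Runs p.actions.toFinset p.x p.y)

/-- The ideal of the input has the form `↓x × D^* × ↓x`, and the runs considered are those from
`x` to `x`; here `D` is a downward-closed subset of the ordered set of transitions. The downward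
closure of `D` in `ℕ^d × A × ℕ^d` is what the list `L` represents. -/
def AdhInput.IsSpecial (p : AdhInput) : Prop :=
  p.y = p.x ∧ p.ideal.src = toOmega p.x ∧ p.ideal.tgt = toOmega p.x ∧
    ∃ L, p.ideal.word = [Atom.star L] ∧
      ∃ D ⊆ Trans p.actions.toFinset,
        (∀ s ∈ Trans p.actions.toFinset, ∀ t ∈ D, s ≤ t → s ∈ D) ∧
        (lowerClosure D : Set (Triple p.actions.toFinset)) = downList L

/-! ### Encoding of the inputs -/

/-- `ω` is encoded as `none`, and a natural number `n` as `some n`. -/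
noncomputable def encodeOmega (n : ℕ∞) : Option ℕ :=
  ENat.recTopCoe (C := fun _ => Option ℕ) none some n

abbrev TripleCode : Type := List (Option ℕ) × List ℤ × List (Option ℕ)

noncomputable def OmegaTriple.encode {A : VAS d} (τ : OmegaTriple A) : TripleCode :=
  (List.ofFn fun i => encodeOmega (τ.src i), List.ofFn τ.act.1,
    List.ofFn fun i => encodeOmega (τ.tgt i))

noncomputable def Atom.encode {A : VAS d} : Atom A → List TripleCode ⊕ TripleCode
  | star L => Sum.inl (L.map OmegaTriple.encode)
  | opt τ => Sum.inr τ.encode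

abbrev IdealCode : Type :=
  List (Option ℕ) × List (List TripleCode ⊕ TripleCode) × List (Option ℕ)

noncomputable def IdealRep.encode {A : VAS d} (I : IdealRep A) : IdealCode :=
  (List.ofFn fun i => encodeOmega (I.src i), I.word.map Atom.encode,
    List.ofFn fun i => encodeOmega (I.tgt i))

/-- The finite data to which algorithms are applied. -/
abbrev AdhCode : Type := ℕ × List (List ℤ) × List ℕ × List ℕ × IdealCode

noncomputable def AdhInput.encode (p : AdhInput) : AdhCode :=
  (p.d, p.actions.map List.ofFn, List.ofFn p.x, List.ofFn p.y, p.ideal.encode)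

/-- Adherence membership is decidable on the inputs in `S`: some partial recursive function halts
on the code of every input in `S` and answers whether it is a positive one. (Nothing is required of
it outside of `S`.) -/
def AdherenceDecidableOn (S : Set AdhInput) : Prop :=
  ∃ f : AdhCode →. Bool, Partrec f ∧
    ∀ p ∈ S, ∃ b ∈ f p.encode, (b = true ↔ p.IsPositive)

end VAS

/-! The halting problem reduces to adherence, because a set `D` of transitions can express zero
tests. Vanishing of a coordinate is a downward-closed condition. A rule that tests the coordinate
`i` and does not change it thus contributes an ideal of triples with `i` bounded by `0` and all
other coordinates by `ω`, in source and target alike. The transitions in the union of these ideals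
are the firings of the rules, and their downward closure is the whole union (`exists_fires`,
`exists_transition_ge`).

If `Δ` witnesses adherence of `↓x × (↓D)^* × ↓x`, its runs lie in the ideal, so they use only
transitions in `D` and respect the zero tests. Hence the source of every transition in `D` can be
covered from `x` by the rules (`exists_reach_of_isPositive`). Conversely, if every transition in `D`
is covered by one on a cycle through `x`, then concatenating cycles gives the directed set `Δ`
(`isPositive_of_forall_exists`).

The rules are those of a counter automaton together with free rules: a token at the end state `b`
gives access to every configuration with a token at `b`, and that token can be dropped. So if `b` is
reachable, everything lies on cycles through `x` (`exists_cycle_of_reach`). If the ideal is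
adherent, a transition whose source has a token at `b` must be covered; since no free rule can fire
before the automaton reaches `b`, the automaton does reach it (`exists_reach_automatonRules_iff`).

The automaton comes from a counter program for a partial recursive function. Programs are regular
expressions with relational semantics, where a wrong guess about leaving a loop blocks. The
invariant of `Computes` is that the registers from `k` on are zero beforehand and that only register
`k` differs afterwards, which makes programs composable. For a universal function the rules are
fixed and only `x` depends on the code of the machine. -/

open Relation

/-! ## Counter programs -/

namespace CounterProgram

/-- A valuation of the registers. -/
abbrev Store : Type := ℕ → ℕ

/-- Elementary instructions; `dec r` blocks if the register `r` is zero, and `test r` blocks if it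
is not. -/
inductive Instr where
  | nop
  | inc (r : ℕ)
  | dec (r : ℕ)
  | test (r : ℕ)

/-- The effect of an instruction. -/
def Instr.Eff : Instr → Store → Store → Prop
  | nop, s, t => t = s
  | inc r, s, t => t = Function.update s r (s r + 1)
  | dec r, s, t => s r ≠ 0 ∧ t = Function.update s r (s r - 1)
  | test r, s, t => s r = 0 ∧ t = s

/-- Regular programs over the elementary instructions. -/
inductive Prog where
  | instr (i : Instr)
  | seq (P Q : Prog)
  | iter (P : Prog)

/-- The input-output relation of a program. -/
def Prog.Exec : Prog → Store → Store → Prop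
  | instr i => i.Eff
  | seq P Q => Comp P.Exec Q.Exec
  | iter P => ReflTransGen P.Exec

open Instr Prog Function

/-- A loop whose body is deterministic along the sequence `S` of stores, and enabled at `S j`
exactly if `g j`. -/
theorem exec_iter_iff {P : Prog} {S : ℕ → Store} {g : ℕ → Prop}
    (h : ∀ j u, P.Exec (S j) u ↔ g j ∧ u = S (j + 1)) {s t : Store} (hs : s = S 0) :
    (iter P).Exec s t ↔ ∃ j, (∀ i < j, g i) ∧ t = S j := by
  subst hs
  constructor
  · intro H
    change ReflTransGen P.Exec (S 0) t at H
    induction H with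
    | refl => exact ⟨0, by simp, rfl⟩
    | tail _ H ih =>
      obtain ⟨j, hj, rfl⟩ := ih
      obtain ⟨hg, rfl⟩ := (h _ _).1 H
      refine ⟨j + 1, fun i hi => ?_, rfl⟩
      rcases Nat.lt_succ_iff_lt_or_eq.1 hi with hi | rfl
      exacts [hj i hi, hg]
  · rintro ⟨j, hj, rfl⟩
    change ReflTransGen P.Exec (S 0) (S j)
    induction j with
    | zero => exact .refl
    | succ j ih =>
      exact .tail (ih fun i hi => hj i (by omega)) ((h _ _).2 ⟨hj j (by omega), rfl⟩)

/-- A loop that counts down the register `r`. -/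
theorem exec_while_iff {P : Prog} {S : ℕ → Store} {r m : ℕ} (hr : ∀ j, S j r = m - j)
    (h : ∀ j u, P.Exec (S j) u ↔ j < m ∧ u = S (j + 1)) {s t : Store} (hs : s = S 0) :
    (seq (iter P) (instr (test r))).Exec s t ↔ t = S m := by
  change (∃ u, (iter P).Exec s u ∧ (u r = 0 ∧ t = u)) ↔ _
  simp only [exec_iter_iff h hs]
  constructor
  · rintro ⟨u, ⟨j, hj, rfl⟩, h0, rfl⟩
    rw [hr] at h0
    have : ¬ m < j := fun hm => lt_irrefl _ (hj m hm)
    rw [show j = m by omega]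
  · rintro rfl
    exact ⟨_, ⟨m, fun i hi => hi, rfl⟩, by rw [hr]; omega, rfl⟩

/-! ### Clearing, moving and copying registers. -/

/-- Set the register `r` to zero. -/
def clear (r : ℕ) : Prog := seq (iter (instr (dec r))) (instr (test r))

theorem exec_clear {r : ℕ} {s t : Store} : (clear r).Exec s t ↔ t = update s r 0 := by
  unfold clear
  rw [exec_while_iff (S := fun j => update s r (s r - j)) (m := s r)]
  · simp
  · simp
  · intro j u
    simp only [Exec, Eff, update_self, update_idem]
    rw [Nat.sub_sub]
    have : s r - j ≠ 0 ↔ j < s r := by omega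
    rw [this]
  · simp

/-- Move the content of the register `i` to the register `j`. -/
def move (i j : ℕ) : Prog :=
  seq (clear j) (seq (iter (seq (instr (dec i)) (instr (inc j)))) (instr (test i)))

theorem exec_move {i j : ℕ} (hij : i ≠ j) {s t : Store} :
    (move i j).Exec s t ↔ t = update (update s j (s i)) i 0 := by
  unfold move
  change (∃ u, (clear j).Exec s u ∧ _) ↔ _
  simp only [exec_clear, exists_eq_left]
  rw [exec_while_iff (S := fun l => update (update s j (min l (s i))) i (s i - l)) (m := s i)]
  · simp
  · simp
  · intro l u
    simp only [Exec, Eff, Comp, and_assoc]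
    constructor
    · rintro ⟨w, h1, rfl, rfl⟩
      simp only [update_self] at h1
      refine ⟨by omega, ?_⟩
      ext r
      simp only [update_apply]
      grind
    · rintro ⟨h1, rfl⟩
      refine ⟨_, ?_, rfl, ?_⟩
      · simp only [update_self]; omega
      · ext r
        simp only [update_apply]
        grind
  · ext r
    simp only [update_apply]
    grind

/-- Copy the content of the register `i` to the register `j`, with the scratch register `k`. -/
def copy (i j k : ℕ) : Prog :=
  seq (clear j) (seq (clear k) (seq
    (seq (iter (seq (instr (dec i)) (seq (instr (inc j)) (instr (inc k))))) (instr (test i)))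
    (move k i)))

theorem exec_copy {i j k : ℕ} (hij : i ≠ j) (hik : i ≠ k) (hjk : j ≠ k) {s t : Store} :
    (copy i j k).Exec s t ↔ t = update (update s j (s i)) k 0 := by
  unfold copy
  change (∃ u, (clear j).Exec s u ∧ ∃ v, (clear k).Exec u v ∧ ∃ w, _ ∧ (move k i).Exec w t) ↔ _
  simp only [exec_clear, exists_eq_left, exec_move hik.symm]
  have key : ∀ w, (seq (iter (seq (instr (dec i)) (seq (instr (inc j)) (instr (inc k)))))
      (instr (test i))).Exec (update (update s j 0) k 0) w ↔
      w = update (update (update s j (s i)) k (s i)) i 0 := by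
    intro w
    rw [exec_while_iff (m := s i)
      (S := fun l => update (update (update s j (min l (s i))) k (min l (s i))) i (s i - l))]
    · simp
    · simp
    · intro l u
      simp only [Exec, Eff, Comp]
      constructor
      · rintro ⟨w, ⟨h1, rfl⟩, w', rfl, rfl⟩
        simp only [update_self] at h1
        refine ⟨by omega, ?_⟩
        ext r
        simp only [update_apply]
        grind
      · rintro ⟨h1, rfl⟩
        refine ⟨_, ⟨?_, rfl⟩, _, rfl, ?_⟩
        · simp only [update_self]; omega
        · ext r
          simp only [update_apply]
          grind
    · ext r
      simp only [update_apply]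
      grind
  simp only [key, exists_eq_left]
  refine Eq.congr_right ?_
  ext r
  simp only [update_apply]
  grind

/-- Clear the registers `k, …, k + m - 1`. -/
def clearRange (k : ℕ) : ℕ → Prog
  | 0 => instr nop
  | m + 1 => seq (clear (k + m)) (clearRange k m)

theorem exec_clearRange {k m : ℕ} {s t : Store} :
    (clearRange k m).Exec s t ↔ t = fun r => if k ≤ r ∧ r < k + m then 0 else s r := by
  induction m generalizing s with
  | zero =>
    have : (fun r => if k ≤ r ∧ r < k + 0 then 0 else s r) = s := by
      ext r; rw [if_neg (by omega)]
    rw [this]; rfl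
  | succ m ih =>
    change (∃ u, (clear (k + m)).Exec s u ∧ _) ↔ _
    simp only [exec_clear, exists_eq_left, ih]
    refine Eq.congr_right ?_
    ext r
    simp only [update_apply]
    grind

/-! ### Programs for the partial recursive functions -/

/-- Whatever the input registers and the first unused register `k`, there is a program that writes
the value of `f` to the register `k`. -/
def Computes {n : ℕ} (f : List.Vector ℕ n →. ℕ) : Prop :=
  ∀ (ins : List.Vector ℕ n) (k : ℕ), (∀ r ∈ ins.toList, r < k) → ∃ P : Prog, ∀ s : Store,
    (∀ r, k ≤ r → s r = 0) → ∀ t, P.Exec s t ↔ ∃ y ∈ f (ins.map s), t = update s k y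

theorem map_congr_of_lt {n k : ℕ} {ins : List.Vector ℕ n} (h : ∀ r ∈ ins.toList, r < k)
    {s t : Store} (hst : ∀ r < k, s r = t r) : ins.map s = ins.map t := by
  apply List.Vector.toList_injective
  simp only [List.Vector.toList_map]
  exact List.map_congr_left fun r hr => hst r (h r hr)

theorem computes_zero : Computes (PFun.lift fun _ : List.Vector ℕ 0 => 0) := by
  intro ins k _
  refine ⟨instr nop, fun s hs t => ?_⟩
  simp only [Exec, Eff, PFun.coe_val, Part.mem_some_iff, exists_eq_left]
  rw [← hs k le_rfl, update_eq_self]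

theorem computes_get {n : ℕ} (i : Fin n) :
    Computes (PFun.lift fun v : List.Vector ℕ n => v.get i) := by
  intro ins k h
  have hi : ins.get i < k := h _ (List.Vector.get_mem i ins)
  refine ⟨copy (ins.get i) k (k + 1), fun s hs t => ?_⟩
  rw [exec_copy (by omega) (by omega) (by omega)]
  simp only [PFun.coe_val, Part.mem_some_iff, exists_eq_left, List.Vector.get_map]
  refine Eq.congr_right ?_
  have := hs (k + 1) (by omega)
  ext r
  simp only [update_apply]
  grind

theorem computes_succ :
    Computes (PFun.lift fun v : List.Vector ℕ 1 => v.head.succ) := by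
  intro ins k h
  obtain ⟨P, hP⟩ := computes_get (0 : Fin 1) ins k h
  refine ⟨seq P (instr (inc k)), fun s hs t => ?_⟩
  change (∃ u, P.Exec s u ∧ t = update u k (u k + 1)) ↔ _
  simp only [hP s hs, PFun.coe_val, Part.mem_some_iff, exists_eq_left, List.Vector.get_map]
  simp

/-- The store that has the list `l` in the registers `k, k + 1, …`. -/
def put (k : ℕ) (l : List ℕ) (s : Store) : Store :=
  fun r => if k ≤ r ∧ r - k < l.length then l.getD (r - k) 0 else s r

theorem put_cons (k a : ℕ) (l : List ℕ) (s : Store) :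
    put k (a :: l) s = put (k + 1) l (update s k a) := by
  ext r
  rcases lt_trichotomy r k with h | rfl | h
  · simp only [put, update_apply]
    grind
  · simp [put]
  · obtain ⟨j, rfl⟩ : ∃ j, r = k + 1 + j := ⟨r - (k + 1), by omega⟩
    have h1 : k + 1 + j - k = j + 1 := by omega
    have h2 : k + 1 + j - (k + 1) = j := by omega
    simp only [put, update_apply, h1, h2, List.length_cons, List.getD_cons_succ]
    grind

/-- The components are evaluated one after the other into consecutive registers; each result counts
as used for the components that follow. -/
theorem computes_tuple {n m : ℕ} (g : Fin m → List.Vector ℕ n →. ℕ) (hg : ∀ i, Computes (g i))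
    (ins : List.Vector ℕ n) (k : ℕ) (h : ∀ r ∈ ins.toList, r < k) :
    ∃ P : Prog, ∀ s : Store, (∀ r, k ≤ r → s r = 0) → ∀ t, P.Exec s t ↔
      ∃ v ∈ List.Vector.mOfFn (m := Part) fun i => g i (ins.map s), t = put k v.toList s := by
  induction m generalizing k with
  | zero =>
    refine ⟨instr nop, fun s _ t => ?_⟩
    have : put k [] s = s := by ext r; simp [put]
    simp [Exec, Eff, List.Vector.mOfFn, this]
  | succ m ih =>
    obtain ⟨P, hP⟩ := hg 0 ins k h
    obtain ⟨Q, hQ⟩ := ih (fun i => g i.succ) (fun i => hg i.succ) (k + 1)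
      fun r hr => (h r hr).trans (Nat.lt_succ_self k)
    refine ⟨seq P Q, fun s hs t => ?_⟩
    change (∃ u, P.Exec s u ∧ Q.Exec u t) ↔ _
    have hmap : ∀ y, ins.map (update s k y) = ins.map s := fun y =>
      map_congr_of_lt h fun r hr => by simp [hr.ne]
    have hQ' : ∀ y, Q.Exec (update s k y) t ↔ _ := fun y =>
      hQ (update s k y) (fun r hr => by
        rw [update_of_ne (by omega)]; exact hs r (by omega)) t
    simp only [hmap] at hQ'
    simp only [hP s hs]
    constructor
    · rintro ⟨_, ⟨y, hy, rfl⟩, h2⟩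
      obtain ⟨v, hv, rfl⟩ := (hQ' y).1 h2
      refine ⟨y ::ᵥ v, ?_, ?_⟩
      · simp only [List.Vector.mOfFn, Part.bind_eq_bind, Part.pure_eq_some, Part.mem_bind_iff,
          Part.mem_some_iff]
        exact ⟨y, hy, v, hv, rfl⟩
      · rw [List.Vector.toList_cons, put_cons]
    · rintro ⟨w, hw, rfl⟩
      simp only [List.Vector.mOfFn, Part.bind_eq_bind, Part.pure_eq_some, Part.mem_bind_iff,
          Part.mem_some_iff] at hw
      obtain ⟨y, hy, v, hv, rfl⟩ := hw
      exact ⟨_, ⟨y, hy, rfl⟩, (hQ' y).2 ⟨v, hv, by rw [List.Vector.toList_cons, put_cons]⟩⟩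

theorem computes_comp {n m : ℕ} {f : List.Vector ℕ m →. ℕ} (g : Fin m → List.Vector ℕ n →. ℕ)
    (hf : Computes f) (hg : ∀ i, Computes (g i)) :
    Computes fun v => (List.Vector.mOfFn fun i => g i v) >>= f := by
  intro ins k h
  obtain ⟨P, hP⟩ := computes_tuple g hg ins k h
  -- The offset is `m + 1` rather than `m` so that the final move to register `k` has distinct
  -- source and target even for `m = 0`.
  obtain ⟨Q, hQ⟩ := hf (List.Vector.ofFn fun i : Fin m => k + i) (k + m + 1) (by
    intro r hr
    rw [List.Vector.toList_ofFn, List.mem_ofFn] at hr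
    obtain ⟨i, rfl⟩ := hr
    omega)
  refine ⟨seq P (seq Q (seq (clearRange k m) (move (k + m + 1) k))), fun s hs t => ?_⟩
  change (∃ u, P.Exec s u ∧ ∃ v, Q.Exec u v ∧ ∃ w, (clearRange k m).Exec v w ∧
    (move (k + m + 1) k).Exec w t) ↔ _
  simp only [hP s hs, exec_clearRange, exists_eq_left, exec_move (show k + m + 1 ≠ k by omega)]
  have hmap : ∀ v : List.Vector ℕ m,
      (List.Vector.ofFn fun i : Fin m => k + (i : ℕ)).map (put k v.toList s) = v := by
    intro v
    ext i
    rw [List.Vector.get_map, List.Vector.get_ofFn]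
    simp [put, List.Vector.get_eq_get_toList]
  have hQ' : ∀ (v : List.Vector ℕ m) t, Q.Exec (put k v.toList s) t ↔ _ := fun v =>
    hQ (put k v.toList s) (fun r hr => by
      have : ¬ (k ≤ r ∧ r - k < v.toList.length) := by simp; omega
      simp only [put, if_neg this]
      exact hs r (by omega))
  simp only [hmap] at hQ'
  have fin : ∀ (v : List.Vector ℕ m) (y : ℕ), update s k y =
      update (update
        (fun r => if k ≤ r ∧ r < k + m then 0 else update (put k v.toList s) (k + m + 1) y r) k
        (if k ≤ k + m + 1 ∧ k + m + 1 < k + m then 0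
          else update (put k v.toList s) (k + m + 1) y (k + m + 1))) (k + m + 1) 0 := by
    intro v y
    ext r
    have := hs r
    simp only [update_apply, put, List.Vector.toList_length]
    grind
  constructor
  · rintro ⟨_, ⟨v, hv, rfl⟩, _, h2, rfl⟩
    obtain ⟨y, hy, rfl⟩ := (hQ' v _).1 h2
    exact ⟨y, Part.mem_bind hv hy, (fin v y).symm⟩
  · rintro ⟨y, hy, rfl⟩
    obtain ⟨v, hv, hy⟩ := Part.mem_bind_iff.1 hy
    exact ⟨_, ⟨v, hv, rfl⟩, _, (hQ' v _).2 ⟨y, hy, rfl⟩, fin v y⟩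

theorem computes_prec {n : ℕ} {f : List.Vector ℕ n → ℕ} {g : List.Vector ℕ (n + 2) → ℕ}
    (hf : Computes (f : List.Vector ℕ n →. ℕ)) (hg : Computes (g : List.Vector ℕ (n + 2) →. ℕ)) :
    Computes (PFun.lift fun v : List.Vector ℕ (n + 1) =>
      v.head.rec (f v.tail) fun y IH => g (y ::ᵥ IH ::ᵥ v.tail)) := by
  intro ins k h
  obtain ⟨a, ins, rfl⟩ := ins.exists_eq_cons
  simp only [List.Vector.toList_cons, List.mem_cons, forall_eq_or_imp] at h
  obtain ⟨ha, h⟩ := h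
  obtain ⟨P, hP⟩ := hf ins k h
  obtain ⟨Q, hQ⟩ := hg ((k + 1) ::ᵥ k ::ᵥ ins) (k + 3) (by
    simp only [List.Vector.toList_cons, List.mem_cons, forall_eq_or_imp]
    exact ⟨by omega, by omega, fun r hr => (h r hr).trans (by omega)⟩)
  -- Register `k` holds the current value, `k + 1` the index of the recursion, `k + 2` the number of
  -- rounds left. Register `k + 3` is scratch space for the copy and then receives the value of `g`.
  refine ⟨seq P (seq (copy a (k + 2) (k + 3)) (seq (seq (iter (seq (instr (dec (k + 2)))
    (seq Q (seq (move (k + 3) k) (instr (inc (k + 1))))))) (instr (test (k + 2))))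
    (clear (k + 1)))), fun s hs t => ?_⟩
  simp only [PFun.coe_val, Part.mem_some_iff, exists_eq_left, List.Vector.map_cons,
    List.Vector.head_cons, List.Vector.tail_cons] at hP hQ ⊢
  change (∃ u, P.Exec s u ∧ ∃ v, (copy a (k + 2) (k + 3)).Exec u v ∧ ∃ w, _ ∧
    (clear (k + 1)).Exec w t) ↔ _
  simp only [hP s hs, exists_eq_left, exec_clear,
    exec_copy (show a ≠ k + 2 by omega) (show a ≠ k + 3 by omega) (show k + 2 ≠ k + 3 by omega)]
  set F : ℕ → ℕ := fun j =>
    Nat.rec (f (ins.map s)) (fun y IH => g (y ::ᵥ IH ::ᵥ ins.map s)) j with hF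
  let S : ℕ → Store := fun j => update (update (update s k (F j)) (k + 1) j) (k + 2) (s a - j)
  have loop : ∀ w, (seq (iter (seq (instr (dec (k + 2)))
      (seq Q (seq (move (k + 3) k) (instr (inc (k + 1))))))) (instr (test (k + 2)))).Exec
      (update (update (update s k (f (ins.map s))) (k + 2)
        (update s k (f (ins.map s)) a)) (k + 3) 0) w ↔ w = S (s a) := by
    intro w
    refine exec_while_iff (S := S) (by simp [S]) ?_ ?_
    · intro j u
      change (∃ v, ((S j (k + 2)) ≠ 0 ∧ v = update (S j) (k + 2) (S j (k + 2) - 1)) ∧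
        ∃ w, Q.Exec v w ∧ ∃ w', (move (k + 3) k).Exec w w' ∧
          u = update w' (k + 1) (w' (k + 1) + 1)) ↔ _
      have hc : ∀ r, k + 3 ≤ r → update (S j) (k + 2) (S j (k + 2) - 1) r = 0 := by
        intro r hr
        have := hs r (by omega)
        simp only [S, update_apply]
        grind
      have hmap : ins.map (update (S j) (k + 2) (S j (k + 2) - 1)) = ins.map s :=
        map_congr_of_lt h fun r hr => by
          simp only [S, update_apply]
          grind
      have hQ' := hQ _ hc
      simp only [hmap] at hQ'
      have e1 : update (S j) (k + 2) (S j (k + 2) - 1) (k + 1) = j := by simp [S]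
      have e2 : update (S j) (k + 2) (S j (k + 2) - 1) k = F j := by simp [S]
      rw [e1, e2] at hQ'
      simp only [and_assoc, exists_and_left, exists_eq_left, hQ',
        exec_move (show k + 3 ≠ k by omega)]
      have e3 : S j (k + 2) ≠ 0 ↔ j < s a := by
        simp only [S, update_self]; omega
      rw [e3]
      refine and_congr_right fun hj => Eq.congr_right ?_
      have := hs (k + 3) (by omega)
      have e4 : F (j + 1) = g (j ::ᵥ F j ::ᵥ ins.map s) := rfl
      ext r
      simp only [S, e4, update_apply]
      grind
    · have e0 : F 0 = f (ins.map s) := rfl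
      have h1 := hs (k + 1) (by omega)
      have h3 := hs (k + 3) (by omega)
      ext r
      simp only [S, e0, update_apply]
      grind
  simp only [loop, exists_eq_left]
  refine Eq.congr_right ?_
  have h1 := hs (k + 1) (by omega)
  have h2 := hs (k + 2) (by omega)
  ext r
  simp only [S, update_apply, Nat.sub_self]
  grind

theorem computes_rfind {n : ℕ} {f : List.Vector ℕ (n + 1) → ℕ}
    (hf : Computes (f : List.Vector ℕ (n + 1) →. ℕ)) :
    Computes fun v => Nat.rfind fun n => Part.some (f (n ::ᵥ v) = 0) := by
  intro ins k h
  obtain ⟨P, hP⟩ := hf (k ::ᵥ ins) (k + 1) (by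
    simp only [List.Vector.toList_cons, List.mem_cons, forall_eq_or_imp]
    exact ⟨by omega, fun r hr => (h r hr).trans (by omega)⟩)
  -- Register `k` holds the candidate and `k + 1` the value of `f` there. The decrement lets the
  -- loop continue only at a nonzero value and the final test lets it end only at zero, so a
  -- completed execution stops at the least root.
  refine ⟨seq (iter (seq P (seq (instr (dec (k + 1))) (seq (clear (k + 1)) (instr (inc k))))))
    (seq P (instr (test (k + 1)))), fun s hs t => ?_⟩
  simp only [PFun.coe_val, Part.mem_some_iff, exists_eq_left, List.Vector.map_cons] at hP
  have hP' : ∀ j t, P.Exec (update s k j) t ↔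
      t = update (update s k j) (k + 1) (f (j ::ᵥ ins.map s)) := by
    intro j t
    rw [hP _ (fun r hr => by rw [update_of_ne (by omega)]; exact hs r (by omega)), update_self,
      map_congr_of_lt h fun r hr => update_of_ne hr.ne _ _]
  have h1 := hs (k + 1) (by omega)
  have loop : ∀ t, (iter (seq P (seq (instr (dec (k + 1)))
      (seq (clear (k + 1)) (instr (inc k)))))).Exec s t ↔ _ := fun t =>
    exec_iter_iff (S := fun j => update s k j) (g := fun j => f (j ::ᵥ ins.map s) ≠ 0) (by
      intro j u
      change (∃ v, P.Exec _ v ∧ ∃ w, (v (k + 1) ≠ 0 ∧ w = update v (k + 1) (v (k + 1) - 1)) ∧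
        ∃ w', (clear (k + 1)).Exec w w' ∧ u = update w' k (w' k + 1)) ↔ _
      simp only [hP', exists_eq_left, exec_clear, and_assoc, exists_and_left, update_self]
      refine and_congr_right fun _ => Eq.congr_right ?_
      ext r
      simp only [update_apply]
      grind) (by rw [← hs k le_rfl, update_eq_self])
  change (∃ u, (iter _).Exec s u ∧ ∃ v, P.Exec u v ∧ (v (k + 1) = 0 ∧ t = v)) ↔ _
  simp only [loop]
  have hmem : ∀ j, j ∈ Nat.rfind (fun n => Part.some (decide (f (n ::ᵥ ins.map s) = 0))) ↔
      f (j ::ᵥ ins.map s) = 0 ∧ ∀ i < j, f (i ::ᵥ ins.map s) ≠ 0 := fun j =>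
    Nat.mem_rfind.trans (and_congr
      (by rw [Part.mem_some_iff, eq_comm, decide_eq_true_iff])
      (forall₂_congr fun i hi => by rw [Part.mem_some_iff, eq_comm, decide_eq_false_iff_not]))
  have hup : ∀ j, f (j ::ᵥ ins.map s) = 0 →
      update (update s k j) (k + 1) (f (j ::ᵥ ins.map s)) = update s k j := by
    intro j hj
    ext r
    simp only [update_apply]
    grind
  constructor
  · rintro ⟨_, ⟨j, hj, rfl⟩, v, hv, h0, rfl⟩
    obtain rfl := (hP' _ _).1 hv
    rw [update_self] at h0
    exact ⟨j, (hmem j).2 ⟨h0, hj⟩, hup j h0⟩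
  · rintro ⟨j, hj, rfl⟩
    obtain ⟨h0, hj⟩ := (hmem j).1 hj
    exact ⟨_, ⟨j, hj, rfl⟩, _, (hP' _ _).2 rfl,
      by simp [h0], (hup j h0).symm⟩

theorem computes_of_primrec {n : ℕ} {f : List.Vector ℕ n → ℕ} (hf : Nat.Primrec' f) :
    Computes (f : List.Vector ℕ n →. ℕ) := by
  induction hf with
  | zero => exact computes_zero
  | succ => exact computes_succ
  | get i => exact computes_get i
  | @comp m n f g _ _ ihf ihg =>
    have := computes_comp (fun i => (g i : List.Vector ℕ m →. ℕ)) ihf ihg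
    have e : (PFun.lift fun v => f (List.Vector.ofFn fun i => g i v)) =
        fun v => (List.Vector.mOfFn fun i => (g i : List.Vector ℕ m →. ℕ) v) >>= PFun.lift f := by
      funext v
      exact (congrArg (· >>= PFun.lift f)
        (Vector.mOfFn_part_some fun i => g i v)).trans (Part.bind_some _ _) |>.symm
    exact e ▸ this
  | prec _ _ ihf ihg => exact computes_prec ihf ihg

theorem computes_of_partrec {n : ℕ} {f : List.Vector ℕ n →. ℕ} (hf : Nat.Partrec' f) :
    Computes f := by
  induction hf with
  | prim hf => exact computes_of_primrec hf
  | comp g _ _ ihf ihg => exact computes_comp g ihf ihg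
  | rfind _ ih => exact computes_rfind ih

/-- For every partial recursive function there is a program that can be executed to the end, from
the store with the input in the register `0`, exactly if the function is defined on the input. -/
theorem exists_prog_of_partrec {f : ℕ →. ℕ} (hf : Partrec f) :
    ∃ P : Prog, ∀ m, (∃ t, P.Exec (update 0 0 m) t) ↔ (f m).Dom := by
  obtain ⟨P, hP⟩ := computes_of_partrec (Nat.Partrec'.part_iff₁.2 hf) (0 ::ᵥ List.Vector.nil) 1
    (by simp)
  refine ⟨P, fun m => ?_⟩
  have h := hP (update 0 0 m) fun r hr => by rw [update_of_ne (by omega)]; rfl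
  refine Iff.trans ?_ Part.dom_iff_mem.symm
  constructor
  · rintro ⟨t, ht⟩
    obtain ⟨y, hy, -⟩ := (h t).1 ht
    exact ⟨y, hy⟩
  · rintro ⟨y, hy⟩
    exact ⟨_, (h _).2 ⟨y, hy, rfl⟩⟩

end CounterProgram

namespace CounterProgram

open Instr Prog

/-! ### Programs as automata -/

/-- A step of the automaton with the edges `E` that acts on the registers. -/
def Step {σ : Type*} (E : List (σ × Instr × σ)) (c c' : σ × Store) : Prop :=
  ∃ i, (c.1, i, c'.1) ∈ E ∧ i.Eff c.2 c'.2

/-- Apply a map to the states of an edge. -/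
def mapEdge {σ τ : Type*} (f : σ → τ) (e : σ × Instr × σ) : τ × Instr × τ :=
  (f e.1, e.2.1, f e.2.2)

theorem Step.lift {σ τ : Type*} {f : σ → τ} {E : List (σ × Instr × σ)}
    {E' : List (τ × Instr × τ)} (h : ∀ e ∈ E, mapEdge f e ∈ E') {p q : σ} {s t : Store}
    (H : ReflTransGen (Step E) (p, s) (q, t)) : ReflTransGen (Step E') (f p, s) (f q, t) :=
  ReflTransGen.lift (fun c : σ × Store => (f c.1, c.2))
    (fun _ _ ⟨i, hi, he⟩ => ⟨i, h _ hi, he⟩) _ _ H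

/-- Sequences are joined by a `nop` edge; an iteration gets one fresh state that serves as entry and
exit. The absence of self-loops is needed later: the rule of an edge must really consume the token
of its source state. -/
theorem exists_automaton (P : Prog) :
    ∃ (σ : Type) (_ : Fintype σ) (_ : DecidableEq σ) (E : List (σ × Instr × σ)) (a b : σ),
      (∀ e ∈ E, e.1 ≠ e.2.2) ∧
      ∀ s t, P.Exec s t ↔ ReflTransGen (Step E) (a, s) (b, t) := by
  induction P with
  | instr i =>
    refine ⟨Bool, inferInstance, inferInstance, [(false, i, true)], false, true, by simp,
      fun s t => ⟨fun h => .single ⟨i, by simp, h⟩, fun h => ?_⟩⟩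
    have key : ∀ c, ReflTransGen (Step [(false, i, true)]) (false, s) c →
        c = (false, s) ∨ c.1 = true ∧ i.Eff s c.2 := by
      intro c hc
      induction hc with
      | refl => exact .inl rfl
      | tail _ h ih =>
        obtain ⟨j, hj, he⟩ := h
        simp only [List.mem_singleton, Prod.mk.injEq] at hj
        obtain ⟨h1, rfl, h2⟩ := hj
        rcases ih with rfl | ⟨h3, -⟩
        · exact .inr ⟨h2, he⟩
        · simp [h3] at h1
    rcases key _ h with h | h
    · simp at h
    · exact h.2
  | seq P Q ihP ihQ =>
    obtain ⟨σ, _, _, E, a, b, hE, h⟩ := ihP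
    obtain ⟨σ', _, _, E', a', b', hE', h'⟩ := ihQ
    let F : List ((σ ⊕ σ') × Instr × (σ ⊕ σ')) :=
      (Sum.inl b, nop, Sum.inr a') :: (E.map (mapEdge Sum.inl) ++ E'.map (mapEdge Sum.inr))
    refine ⟨σ ⊕ σ', inferInstance, inferInstance, F, .inl a, .inr b', ?_, fun s t => ?_⟩
    · intro e he
      simp only [F, List.mem_cons, List.mem_append, List.mem_map] at he
      rcases he with rfl | ⟨e, he, rfl⟩ | ⟨e, he, rfl⟩
      · simp
      · simpa [mapEdge] using hE e he
      · simpa [mapEdge] using hE' e he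
    constructor
    · rintro ⟨u, h1, h2⟩
      have h3 := Step.lift (E' := F) (f := Sum.inl) (by
        intro e he; simp only [F, List.mem_cons, List.mem_append, List.mem_map]
        exact .inr (.inl ⟨e, he, rfl⟩)) ((h _ _).1 h1)
      have h4 := Step.lift (E' := F) (f := Sum.inr) (by
        intro e he; simp only [F, List.mem_cons, List.mem_append, List.mem_map]
        exact .inr (.inr ⟨e, he, rfl⟩)) ((h' _ _).1 h2)
      have e : Step F (.inl b, u) (.inr a', u) := ⟨nop, List.mem_cons_self, rfl⟩
      exact (h3.tail e).trans h4
    · intro H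
      -- The only edge between the two copies leads from `b` to `a'`, so a configuration in the
      -- right copy determines a completed execution of the left automaton.
      have key : ∀ c, ReflTransGen (Step F) (.inl a, s) c → match c with
          | (.inl p, t) => ReflTransGen (Step E) (a, s) (p, t)
          | (.inr p, t) => ∃ u, ReflTransGen (Step E) (a, s) (b, u) ∧
              ReflTransGen (Step E') (a', u) (p, t) := by
        intro c hc
        induction hc with
        | refl => exact .refl
        | @tail c c' _ h ih =>
          obtain ⟨i, hi, he⟩ := h
          obtain ⟨p, t⟩ := c
          obtain ⟨p', t'⟩ := c'
          simp only [F, List.mem_cons, List.mem_append, List.mem_map, mapEdge,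
            Prod.mk.injEq] at hi
          rcases hi with ⟨rfl, rfl, rfl⟩ | ⟨e, h1, rfl, rfl, rfl⟩ | ⟨e, h1, rfl, rfl, rfl⟩
          · obtain rfl : t' = t := he
            exact ⟨_, ih, .refl⟩
          · exact ReflTransGen.tail ih ⟨_, h1, he⟩
          · obtain ⟨u, h2, h3⟩ := ih
            exact ⟨u, h2, h3.tail ⟨_, h1, he⟩⟩
      obtain ⟨u, h1, h2⟩ := key _ H
      exact ⟨u, (h _ _).2 h1, (h' _ _).2 h2⟩
  | iter P ih =>
    obtain ⟨σ, _, _, E, a, b, hE, h⟩ := ih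
    let F : List (Option σ × Instr × Option σ) :=
      (none, nop, some a) :: (some b, nop, none) :: E.map (mapEdge some)
    refine ⟨Option σ, inferInstance, inferInstance, F, none, none, ?_, fun s t => ?_⟩
    · intro e he
      simp only [F, List.mem_cons, List.mem_map] at he
      rcases he with rfl | rfl | ⟨e, he, rfl⟩
      · simp
      · simp
      · simpa [mapEdge] using hE e he
    constructor
    · intro H
      change ReflTransGen P.Exec s t at H
      induction H with
      | refl => exact .refl
      | @tail u v _ h1 ih =>
        have e1 : Step F (none, u) (some a, u) := ⟨nop, List.mem_cons_self, rfl⟩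
        have e2 : Step F (some b, v) (none, v) :=
          ⟨nop, List.mem_cons_of_mem _ List.mem_cons_self, rfl⟩
        have h3 := Step.lift (E' := F) (f := some) (by
          intro e he; simp only [F, List.mem_cons, List.mem_map]
          exact .inr (.inr ⟨e, he, rfl⟩)) ((h _ _).1 h1)
        exact ((ih.tail e1).trans h3).tail e2
    · intro H
      -- The fresh state separates the rounds: at `none` all rounds are complete, and elsewhere
      -- complete rounds are followed by a partial one.
      have key : ∀ c, ReflTransGen (Step F) (none, s) c → match c with
          | (none, t) => ReflTransGen P.Exec s t
          | (some p, t) => ∃ u, ReflTransGen P.Exec s u ∧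
              ReflTransGen (Step E) (a, u) (p, t) := by
        intro c hc
        induction hc with
        | refl => exact .refl
        | @tail c c' _ h1 ih =>
          obtain ⟨i, hi, he⟩ := h1
          obtain ⟨p, t⟩ := c
          obtain ⟨p', t'⟩ := c'
          simp only [F, List.mem_cons, List.mem_map, mapEdge, Prod.mk.injEq] at hi
          rcases hi with ⟨rfl, rfl, rfl⟩ | ⟨rfl, rfl, rfl⟩ | ⟨e, h1, rfl, rfl, rfl⟩
          · obtain rfl : t' = t := he
            exact ⟨_, ih, .refl⟩
          · obtain rfl : t' = t := he
            obtain ⟨u, h2, h3⟩ := ih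
            exact h2.tail ((h _ _).2 h3)
          · obtain ⟨u, h2, h3⟩ := ih
            exact ⟨u, h2, h3.tail ⟨_, h1, he⟩⟩
      exact key _ H

end CounterProgram

namespace VAS

/-! ## Rules with a zero test -/

/-- An action, possibly guarded by a zero test of a coordinate. -/
structure Rule (ι : Type*) where
  act : ι → ℤ
  zero : Option ι

/-- The rule leads from `u` to `v`. -/
def Rule.Fires {ι : Type*} (r : Rule ι) (u v : ι → ℕ) : Prop :=
  (∀ i, (v i : ℤ) = u i + r.act i) ∧ ∀ i ∈ r.zero, u i = 0

/-- Reachability by a finite set of rules. -/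
def Reach {ι : Type*} (R : List (Rule ι)) : (ι → ℕ) → (ι → ℕ) → Prop :=
  ReflTransGen fun u v => ∃ r ∈ R, r.Fires u v

/-- Rename the coordinates of a rule. -/
def Rule.reindex {ι κ : Type*} (e : ι ≃ κ) (r : Rule ι) : Rule κ :=
  ⟨r.act ∘ e.symm, r.zero.map e⟩

theorem Rule.fires_reindex {ι κ : Type*} (e : ι ≃ κ) (r : Rule ι) {u v : κ → ℕ} :
    (r.reindex e).Fires u v ↔ r.Fires (u ∘ e) (v ∘ e) := by
  simp only [Fires, reindex, Function.comp_apply]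
  refine and_congr ?_ (by simp)
  rw [← e.forall_congr_right]
  simp

theorem reach_reindex {ι κ : Type*} (e : ι ≃ κ) (R : List (Rule ι)) {u v : κ → ℕ} :
    Reach (R.map (Rule.reindex e)) u v ↔ Reach R (u ∘ e) (v ∘ e) := by
  constructor
  · refine ReflTransGen.lift (fun u : κ → ℕ => u ∘ e) ?_ _ _
    rintro u v ⟨_, hr, h⟩
    obtain ⟨r, hr', rfl⟩ := List.mem_map.1 hr
    exact ⟨r, hr', (r.fires_reindex e).1 h⟩
  · intro h
    have := ReflTransGen.lift (p := fun u v => ∃ r ∈ R.map (Rule.reindex e), r.Fires u v)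
      (fun u : ι → ℕ => u ∘ e.symm) (fun u v ⟨r, hr, h⟩ => ⟨r.reindex e,
        List.mem_map_of_mem hr, (r.fires_reindex e).2 (by
          simpa [Function.comp_assoc] using h)⟩) _ _ h
    simpa [Function.comp_assoc, Reach, Function.onFun] using this

variable {d : ℕ}

/-! ### The input that belongs to a finite set of rules -/

/-- The upper bound of the sources, and of the targets, of the transitions of a rule. -/
def Rule.bound (r : Rule (Fin d)) : Fin d → ℕ∞ := fun i => if i ∈ r.zero then 0 else ⊤

/-- The ideals that belong to the rules. -/
def ruleTriples (R : List (Rule (Fin d))) : List (OmegaTriple (R.map Rule.act).toFinset) :=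
  R.attach.map fun r => ⟨r.1.bound, ⟨r.1.act, List.mem_toFinset.2 (List.mem_map_of_mem r.2)⟩,
    r.1.bound⟩

/-- The representation of the ideal `↓x × D^* × ↓x`, where `D` is the set of transitions by
rules. -/
def ruleIdeal (R : List (Rule (Fin d))) (x : Fin d → ℕ) : IdealRep (R.map Rule.act).toFinset :=
  ⟨toOmega x, [.star (ruleTriples R)], toOmega x⟩

/-- The input with the ideal `↓x × D^* × ↓x`, where `D` is the set of transitions by rules. -/
def ruleInput (R : List (Rule (Fin d))) (x : Fin d → ℕ) : AdhInput where
  d := d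
  actions := R.map Rule.act
  x := x
  y := x
  ideal := ruleIdeal R x

theorem mem_downVec_bound {r : Rule (Fin d)} {u : Fin d → ℕ} :
    u ∈ downVec r.bound ↔ ∀ i ∈ r.zero, u i = 0 := by
  refine forall_congr' fun i => ?_
  by_cases h : i ∈ r.zero <;> simp [toOmega, Rule.bound, h]

theorem mem_downVec_toOmega {x u : Fin d → ℕ} : u ∈ downVec (toOmega x) ↔ u ≤ x := by
  simp [downVec, toOmega, Pi.le_def]

theorem mem_downList_ruleTriples {R : List (Rule (Fin d))}
    {t : Triple (R.map Rule.act).toFinset} :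
    t ∈ downList (ruleTriples R) ↔ ∃ r ∈ R, t.act.1 = r.act ∧
      ∀ i ∈ r.zero, t.src i = 0 ∧ t.tgt i = 0 := by
  constructor
  · rintro ⟨τ, hτ, h1, h2, h3⟩
    obtain ⟨⟨r, hr⟩, -, rfl⟩ := List.mem_map.1 hτ
    exact ⟨r, hr, congrArg Subtype.val h2,
      fun i hi => ⟨mem_downVec_bound.1 h1 i hi, mem_downVec_bound.1 h3 i hi⟩⟩
  · rintro ⟨r, hr, h1, h2⟩
    exact ⟨_, List.mem_map.2 ⟨⟨r, hr⟩, List.mem_attach _ _, rfl⟩,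
      mem_downVec_bound.2 fun i hi => (h2 i hi).1, Subtype.ext h1,
      mem_downVec_bound.2 fun i hi => (h2 i hi).2⟩

theorem downList_mono {A : VAS d} {L : List (OmegaTriple A)} {s t : Triple A} (h : s ≤ t)
    (ht : t ∈ downList L) : s ∈ downList L := by
  obtain ⟨τ, hτ, ht⟩ := ht
  exact ⟨τ, hτ, τ.down_mono h ht⟩

/-- This is where membership in the ideal forces a run to respect the zero tests. -/
theorem exists_fires {R : List (Rule (Fin d))} {t : Triple (R.map Rule.act).toFinset}
    (ht : t.IsTransition) (h : t ∈ downList (ruleTriples R)) :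
    ∃ r ∈ R, t.act.1 = r.act ∧ r.Fires t.src t.tgt := by
  obtain ⟨r, hr, h1, h2⟩ := mem_downList_ruleTriples.1 h
  exact ⟨r, hr, h1, fun i => by rw [ht i, h1], fun i hi => (h2 i hi).1⟩

/-- A tested coordinate is not changed by the rule, so it vanishes in the target as well, as the
ideal of the rule demands. -/
theorem mem_downList_of_fires {R : List (Rule (Fin d))}
    (hR : ∀ r ∈ R, ∀ i ∈ r.zero, r.act i = 0) {r : Rule (Fin d)} (hr : r ∈ R) {u v : Fin d → ℕ}
    (h : r.Fires u v) {a : {a : Fin d → ℤ // a ∈ (R.map Rule.act).toFinset}} (ha : a.1 = r.act) :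
    (⟨u, a, v⟩ : Triple (R.map Rule.act).toFinset).IsTransition ∧
      (⟨u, a, v⟩ : Triple (R.map Rule.act).toFinset) ∈ downList (ruleTriples R) := by
  refine ⟨fun i => by simp only [ha, h.1 i],
    mem_downList_ruleTriples.2 ⟨r, hr, ha, fun i hi => ⟨h.2 i hi, ?_⟩⟩⟩
  have := h.1 i
  rw [h.2 i hi, hR r hr i hi] at this
  exact_mod_cast this

/-- Every element of `ℕ^d × A × ℕ^d` that respects the zero test of a rule is below a transition
by that rule. -/
theorem exists_transition_ge {R : List (Rule (Fin d))}
    (hR : ∀ r ∈ R, ∀ i ∈ r.zero, r.act i = 0) {t : Triple (R.map Rule.act).toFinset}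
    (h : t ∈ downList (ruleTriples R)) :
    ∃ r ∈ R, t.act.1 = r.act ∧ ∃ u v, r.Fires u v ∧ t.src ≤ u ∧ t.tgt ≤ v := by
  obtain ⟨r, hr, h1, h2⟩ := mem_downList_ruleTriples.1 h
  have key : ∀ i, ∃ a b : ℕ, (b : ℤ) = a + r.act i ∧ (i ∈ r.zero → a = 0) ∧
      t.src i ≤ a ∧ t.tgt i ≤ b := by
    intro i
    by_cases hi : i ∈ r.zero
    · have := h2 i hi
      exact ⟨0, 0, by simp [hR r hr i hi], fun _ => rfl, by omega, by omega⟩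
    -- At an untested coordinate the source is so large that it exceeds `t.src i` and still exceeds
    -- `t.tgt i` after the action.
    · exact ⟨t.src i + t.tgt i + (r.act i).natAbs,
        (t.src i + t.tgt i + (r.act i).natAbs + r.act i).toNat, by omega,
        fun h => absurd h hi, by omega, by omega⟩
  choose u v h3 h4 h5 h6 using key
  exact ⟨r, hr, h1, u, v, ⟨h3, h4⟩, h5, h6⟩

theorem isSpecial_ruleInput {R : List (Rule (Fin d))}
    (hR : ∀ r ∈ R, ∀ i ∈ r.zero, r.act i = 0) (x : Fin d → ℕ) : (ruleInput R x).IsSpecial := by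
  refine ⟨rfl, rfl, rfl, ruleTriples R, rfl, {t | t.IsTransition ∧ t ∈ downList (ruleTriples R)},
    fun t ht => ht.1, fun s hs t ht h => ⟨hs, downList_mono h ht.2⟩, ?_⟩
  ext t
  constructor
  · rintro ⟨t', ⟨-, h⟩, hle⟩
    exact downList_mono hle h
  · intro h
    obtain ⟨r, hr, ha, u, v, hf, hu, hv⟩ := exists_transition_ge hR h
    exact ⟨⟨u, t.act, v⟩, mem_downList_of_fires hR hr hf ha, hu, rfl, hv⟩

/-! ### Runs inside the ideal and reachability by the rules. -/

theorem connects_append {A : VAS d} {u v : Fin d → ℕ} {w w' : List (Triple A)} :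
    Connects u (w ++ w') v ↔ ∃ z, Connects u w z ∧ Connects z w' v := by
  induction w generalizing u with
  | nil => simp [Connects]
  | cons t w ih => simp [Connects, ih, and_assoc]

theorem reach_of_connects {R : List (Rule (Fin d))} {u v : Fin d → ℕ}
    {w : List (Triple (R.map Rule.act).toFinset)} (h : Connects u w v)
    (hw : ∀ t ∈ w, t ∈ downList (ruleTriples R)) : Reach R u v := by
  induction w generalizing u with
  | nil => obtain rfl : u = v := h; exact .refl
  | cons t w ih =>
    obtain ⟨rfl, ht, h⟩ := h
    obtain ⟨r, hr, -, hf⟩ := exists_fires ht (hw t List.mem_cons_self)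
    exact .head ⟨r, hr, hf⟩ (ih h fun t ht => hw t (List.mem_cons_of_mem _ ht))

theorem exists_connects {R : List (Rule (Fin d))} (hR : ∀ r ∈ R, ∀ i ∈ r.zero, r.act i = 0)
    {u v : Fin d → ℕ} (h : Reach R u v) :
    ∃ w : List (Triple (R.map Rule.act).toFinset), Connects u w v ∧
      ∀ t ∈ w, t ∈ downList (ruleTriples R) := by
  induction h with
  | refl => exact ⟨[], rfl, by simp⟩
  | @tail z v _ h ih =>
    obtain ⟨r, hr, hf⟩ := h
    obtain ⟨w, h1, h2⟩ := ih
    obtain ⟨h3, h4⟩ := mem_downList_of_fires hR hr hf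
      (a := ⟨r.act, List.mem_toFinset.2 (List.mem_map_of_mem hr)⟩) rfl
    refine ⟨w ++ [⟨z, ⟨r.act, List.mem_toFinset.2 (List.mem_map_of_mem hr)⟩, v⟩], connects_append.2 ⟨z, h1, ?_⟩, fun t ht => ?_⟩
    · exact ⟨rfl, h3, rfl⟩
    rcases List.mem_append.1 ht with ht | ht
    · exact h2 t ht
    · rw [List.mem_singleton.1 ht]; exact h4

theorem isPositive_ruleInput_iff {R : List (Rule (Fin d))} {x : Fin d → ℕ} :
    (ruleInput R x).IsPositive ↔
      IsAdherent (ruleIdeal R x).toIdeal (Runs (R.map Rule.act).toFinset x x) :=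
  Iff.rfl

theorem mem_ruleIdeal {R : List (Rule (Fin d))} {x : Fin d → ℕ}
    {ρ : Prerun (R.map Rule.act).toFinset} :
    ρ ∈ ((ruleIdeal R x).toIdeal : Set (Prerun (R.map Rule.act).toFinset)) ↔
      ρ.src ≤ x ∧ (∀ t ∈ ρ.word, t ∈ downList (ruleTriples R)) ∧ ρ.tgt ≤ x := by
  refine and_congr mem_downVec_toOmega (and_congr ?_ mem_downVec_toOmega)
  constructor
  · rintro ⟨w, hw, w', rfl, h⟩ t ht
    rw [List.append_nil] at h
    exact hw t (h ▸ ht)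
  · intro h
    exact ⟨ρ.word, h, [], rfl, (List.append_nil _).symm⟩

/-- If the ideal is adherent, then the source of every transition by a rule can be covered. -/
theorem exists_reach_of_isPositive {R : List (Rule (Fin d))}
    (hR : ∀ r ∈ R, ∀ i ∈ r.zero, r.act i = 0) {x : Fin d → ℕ}
    (h : (ruleInput R x).IsPositive) {r : Rule (Fin d)} (hr : r ∈ R) {u v : Fin d → ℕ}
    (hf : r.Fires u v) : ∃ u', Reach R x u' ∧ u ≤ u' := by
  obtain ⟨Δ, hΔ, -, hI⟩ := isPositive_ruleInput_iff.1 h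
  obtain ⟨-, h2⟩ := mem_downList_of_fires hR hr hf
    (a := ⟨r.act, List.mem_toFinset.2 (List.mem_map_of_mem hr)⟩) rfl
  -- The prerun whose only letter is the given transition lies in the ideal, so some run in `Δ`
  -- covers it.
  have hmem : (⟨x, [⟨u, ⟨r.act, List.mem_toFinset.2 (List.mem_map_of_mem hr)⟩, v⟩], x⟩ :
      Prerun (R.map Rule.act).toFinset) ∈ (lowerClosure Δ : Set _) := by
    rw [hI]
    exact mem_ruleIdeal.2 ⟨le_rfl, by simpa using h2, le_rfl⟩
  obtain ⟨ρ, hρ, hle⟩ := hmem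
  -- The covering run belongs to the ideal itself, hence all its transitions are firings of rules;
  -- its prefix before the covering letter is the required path.
  have hρI : ρ ∈ (lowerClosure Δ : Set _) := subset_lowerClosure hρ
  rw [hI] at hρI
  obtain ⟨-, hw, -⟩ := mem_ruleIdeal.1 hρI
  obtain ⟨hrun, hsrc, htgt⟩ := hΔ hρ
  obtain ⟨t, ht, hlt⟩ := embed_mem hle.2.1 _ List.mem_cons_self
  obtain ⟨w₁, w₂, hsplit⟩ := List.append_of_mem ht
  have hc : Connects ρ.src ρ.word ρ.tgt := hrun
  rw [hsplit, connects_append] at hc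
  obtain ⟨z, hz, h3, -⟩ := hc
  have hsrc : ρ.src = x := hsrc
  refine ⟨z, hsrc ▸ reach_of_connects hz fun t ht => hw t ?_, ?_⟩
  · rw [hsplit]; exact List.mem_append_left _ ht
  · rw [← h3]; exact hlt.1

/-- If every transition by a rule can be covered on a cycle, then the ideal is adherent. -/
theorem isPositive_of_forall_exists {R : List (Rule (Fin d))}
    (hR : ∀ r ∈ R, ∀ i ∈ r.zero, r.act i = 0) {x : Fin d → ℕ}
    (h : ∀ r ∈ R, ∀ u v, r.Fires u v → ∃ u' v', u ≤ u' ∧ v ≤ v' ∧ r.Fires u' v' ∧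
      Reach R x u' ∧ Reach R v' x) : (ruleInput R x).IsPositive := by
  let A : VAS d := (R.map Rule.act).toFinset
  have refl : ∀ w : List (Triple A), List.SublistForall₂ (· ≤ ·) w w :=
    List.SublistForall₂.is_refl.refl
  -- All cycles at `x` that respect the tests; concatenation makes this set directed.
  let Δ : Set (Prerun A) := {ρ | ρ ∈ Runs A x x ∧ ∀ t ∈ ρ.word, t ∈ downList (ruleTriples R)}
  refine isPositive_ruleInput_iff.2 ⟨Δ, fun ρ hρ => hρ.1, ?_, ?_⟩
  · rintro ρ ⟨⟨h1, h2, h3⟩, h4⟩ τ ⟨⟨h5, h6, h7⟩, h8⟩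
    replace h1 : Connects ρ.src ρ.word ρ.tgt := h1
    replace h5 : Connects τ.src τ.word τ.tgt := h5
    rw [h2, h3] at h1
    rw [h6, h7] at h5
    refine ⟨⟨x, ρ.word ++ τ.word, x⟩, ⟨⟨connects_append.2 ⟨x, h1, h5⟩, rfl, rfl⟩, ?_⟩,
      ⟨h2.le, ?_, h3.le⟩, ⟨h6.le, ?_, h7.le⟩⟩
    · intro t ht
      rcases List.mem_append.1 ht with ht | ht
      exacts [h4 t ht, h8 t ht]
    · simpa using embed_append (refl ρ.word) (.nil : List.SublistForall₂ (· ≤ ·) [] τ.word)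
    · simpa using embed_append (.nil : List.SublistForall₂ (· ≤ ·) [] ρ.word) (refl τ.word)
  · ext ρ
    refine Iff.trans ?_ mem_ruleIdeal.symm
    constructor
    · rintro ⟨τ, ⟨⟨-, h1, h2⟩, h3⟩, hle⟩
      refine ⟨hle.1.trans h1.le, fun t ht => ?_, hle.2.2.trans h2.le⟩
      obtain ⟨t', ht', hlt⟩ := embed_mem hle.2.1 t ht
      exact downList_mono hlt (h3 t' ht')
    · rintro ⟨h1, h2, h3⟩
      -- Each letter of `w` is covered on a cycle of its own, and the cycles are concatenated.
      suffices H : ∀ w : List (Triple A), (∀ t ∈ w, t ∈ downList (ruleTriples R)) →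
          ∃ w', List.SublistForall₂ (· ≤ ·) w w' ∧ Connects x w' x ∧
            ∀ t ∈ w', t ∈ downList (ruleTriples R) by
        obtain ⟨w', h4, h5, h6⟩ := H _ h2
        exact ⟨⟨x, w', x⟩, ⟨⟨h5, rfl, rfl⟩, h6⟩, h1, h4, h3⟩
      intro w hw
      induction w with
      | nil => exact ⟨[], .nil, rfl, by simp⟩
      | cons t w ih =>
        obtain ⟨w', h4, h5, h6⟩ := ih fun t ht => hw t (List.mem_cons_of_mem _ ht)
        obtain ⟨r, hr, ha, u, v, hf, hu, hv⟩ := exists_transition_ge hR (hw t List.mem_cons_self)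
        obtain ⟨u', v', hu', hv', hf', hx, hx'⟩ := h r hr u v hf
        obtain ⟨w₁, h7, h8⟩ := exists_connects hR hx
        obtain ⟨w₂, h9, h10⟩ := exists_connects hR hx'
        obtain ⟨h11, h12⟩ := mem_downList_of_fires hR hr hf' ha
        refine ⟨(w₁ ++ ⟨u', t.act, v'⟩ :: w₂) ++ w', ?_, ?_, ?_⟩
        · have e1 : List.SublistForall₂ (· ≤ ·) [t] (⟨u', t.act, v'⟩ :: w₂) :=
            .cons ⟨hu.trans hu', rfl, hv.trans hv'⟩ .nil
          have e2 : List.SublistForall₂ (· ≤ ·) ([] ++ [t]) (w₁ ++ ⟨u', t.act, v'⟩ :: w₂) :=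
            embed_append .nil e1
          exact embed_append e2 h4
        · exact connects_append.2 ⟨x, connects_append.2 ⟨u', h7, rfl, h11, h9⟩, h5⟩
        · intro s hs
          simp only [List.mem_append, List.mem_cons] at hs
          rcases hs with (hs | rfl | hs) | hs
          exacts [h8 s hs, h12, h10 s hs, h6 s hs]

end VAS

namespace VAS

/-! ## Free rules -/

theorem Reach.of_fires {ι : Type*} {R : List (Rule ι)} {r : Rule ι} (hr : r ∈ R) {u v : ι → ℕ}
    (hf : r.Fires u v) : Reach R u v :=
  ReflTransGen.single ⟨r, hr, hf⟩

section FreeRules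

variable {ι : Type*} [Fintype ι] [DecidableEq ι]

/-- Exchange a token at `b` for a token at `h` and add a token at `c`. -/
def addRule (b h c : ι) : Rule ι :=
  ⟨Pi.single h 1 + Pi.single c 1 - Pi.single b 1, none⟩

/-- Exchange a token at `b` for a token at `h` and remove a token at `c`. -/
def subRule (b h c : ι) : Rule ι :=
  ⟨Pi.single h 1 - Pi.single c 1 - Pi.single b 1, none⟩

/-- Exchange a token at `h` for a token at `b`. -/
def backRule (b h : ι) : Rule ι :=
  ⟨Pi.single b 1 - Pi.single h 1, none⟩

/-- The rules that allow arbitrary changes of the configuration when there is a token at `b`, and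
that cannot be used when there is none at `b` and `h`. -/
noncomputable def freeRules (b h : ι) : List (Rule ι) :=
  backRule b h :: ((Finset.univ.toList.filter (· ≠ b)).map (addRule b h) ++
    Finset.univ.toList.map (subRule b h))

theorem mem_freeRules {b h : ι} {r : Rule ι} :
    r ∈ freeRules b h ↔ r = backRule b h ∨ (∃ c, c ≠ b ∧ r = addRule b h c) ∨
      ∃ c, r = subRule b h c := by
  simp only [freeRules, List.mem_cons, List.mem_append, List.mem_map, List.mem_filter,
    Finset.mem_toList, Finset.mem_univ, true_and, decide_eq_true_eq, eq_comm (b := r)]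

theorem zero_of_mem_freeRules {b h : ι} {r : Rule ι} (hr : r ∈ freeRules b h) :
    r.zero = none := by
  rcases mem_freeRules.1 hr with rfl | ⟨c, -, rfl⟩ | ⟨c, rfl⟩ <;> rfl

/-- An action can check for a token only by consuming it; this is why the token travels from `b` to
`h` and back. Adding at `c = b` is excluded, since its net effect would be to create a token at `h`
without any precondition. -/
theorem pos_of_fires_freeRules {b h : ι} (hbh : h ≠ b) {r : Rule ι} (hr : r ∈ freeRules b h)
    {u v : ι → ℕ} (hf : r.Fires u v) : 1 ≤ u b ∨ 1 ≤ u h := by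
  have hb := hf.1 b
  have hh := hf.1 h
  rcases mem_freeRules.1 hr with rfl | ⟨c, hc, rfl⟩ | ⟨c, rfl⟩
  · simp only [backRule, Pi.sub_apply, Pi.single_apply, if_neg hbh, if_neg hbh.symm] at hb hh
    grind
  · simp only [addRule, Pi.sub_apply, Pi.add_apply, Pi.single_apply, if_neg hbh.symm,
      if_neg hc.symm] at hb
    grind
  · simp only [subRule, Pi.sub_apply, Pi.single_apply, if_neg hbh.symm] at hb
    grind

theorem reach_back {b h : ι} (hbh : h ≠ b) {R : List (Rule ι)} (hR : freeRules b h ⊆ R)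
    (u : ι → ℕ) : Reach R (u + Pi.single h 1) (u + Pi.single b 1) := by
  refine .of_fires (hR (mem_freeRules.2 (.inl rfl))) ⟨fun i => ?_, by simp [backRule]⟩
  simp only [backRule, Pi.add_apply, Pi.sub_apply, Pi.single_apply]
  grind

theorem reach_add_token {b h : ι} (hbh : h ≠ b) {R : List (Rule ι)} (hR : freeRules b h ⊆ R)
    {c : ι} (hc : c ≠ b) (u : ι → ℕ) :
    Reach R (u + Pi.single b 1) (u + Pi.single b 1 + Pi.single c 1) := by
  refine ReflTransGen.trans (b := u + Pi.single c 1 + Pi.single h 1)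
    (Reach.of_fires (hR (mem_freeRules.2 (.inr (.inl ⟨c, hc, rfl⟩))))
      ⟨fun i => ?_, by simp [addRule]⟩) ?_
  · simp only [addRule, Pi.add_apply, Pi.sub_apply, Pi.single_apply]
    grind
  · rw [add_right_comm u (Pi.single b 1)]
    exact reach_back hbh hR _

/-- For `c = h` the rule `subRule` creates and removes a token at `h`, so that its net effect is to
remove one at `b`. -/
theorem reach_drop {b h : ι} {R : List (Rule ι)} (hR : freeRules b h ⊆ R) (u : ι → ℕ) :
    Reach R (u + Pi.single b 1) u := by
  refine .of_fires (hR (mem_freeRules.2 (.inr (.inr ⟨h, rfl⟩)))) ⟨fun i => ?_, by simp [subRule]⟩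
  simp only [subRule, Pi.add_apply, Pi.sub_apply, Pi.single_apply]
  grind

theorem reach_single {b h : ι} (hbh : h ≠ b) {R : List (Rule ι)} (hR : freeRules b h ⊆ R) (c : ι)
    (u : ι → ℕ) :
    Reach R (u + Pi.single b 1) (u + Pi.single b 1 + Pi.single c 1) ∧
      Reach R (u + Pi.single b 1 + Pi.single c 1) (u + Pi.single b 1) := by
  by_cases hc : c = b
  · subst hc
    -- A second token at `b` is obtained by adding one at `h` and bringing it back.
    exact ⟨(reach_add_token hbh hR hbh u).trans (reach_back hbh hR _), reach_drop hR _⟩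
  refine ⟨reach_add_token hbh hR hc u, ?_⟩
  by_cases hch : c = h
  · subst hch
    exact (reach_back hbh hR _).trans (reach_drop hR _)
  refine ReflTransGen.trans (b := u + Pi.single h 1)
    (Reach.of_fires (hR (mem_freeRules.2 (.inr (.inr ⟨c, rfl⟩)))) ⟨fun i => ?_, by simp [subRule]⟩)
    (reach_back hbh hR _)
  simp only [subRule, Pi.add_apply, Pi.sub_apply, Pi.single_apply]
  grind

theorem reach_add {b h : ι} (hbh : h ≠ b) {R : List (Rule ι)} (hR : freeRules b h ⊆ R)
    (z : ι → ℕ) (u : ι → ℕ) :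
    Reach R (u + Pi.single b 1) (u + Pi.single b 1 + z) ∧
      Reach R (u + Pi.single b 1 + z) (u + Pi.single b 1) := by
  -- Keeping `u` universal makes the property additive in `z`: the second summand is handled at `u +
  -- z`. Unit vectors then suffice.
  suffices H : ∀ z : ι → ℕ, ∀ u,
      Reach R (u + Pi.single b 1) (u + Pi.single b 1 + z) ∧
        Reach R (u + Pi.single b 1 + z) (u + Pi.single b 1) from H z u
  have h0 : ∀ u : ι → ℕ, Reach R (u + Pi.single b 1) (u + Pi.single b 1 + 0) ∧
        Reach R (u + Pi.single b 1 + 0) (u + Pi.single b 1) :=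
    fun u => by rw [add_zero]; exact ⟨.refl, .refl⟩
  have hadd : ∀ z z' : ι → ℕ,
      (∀ u : ι → ℕ, Reach R (u + Pi.single b 1) (u + Pi.single b 1 + z) ∧
        Reach R (u + Pi.single b 1 + z) (u + Pi.single b 1)) →
      (∀ u : ι → ℕ, Reach R (u + Pi.single b 1) (u + Pi.single b 1 + z') ∧
        Reach R (u + Pi.single b 1 + z') (u + Pi.single b 1)) →
      ∀ u : ι → ℕ, Reach R (u + Pi.single b 1) (u + Pi.single b 1 + (z + z')) ∧
        Reach R (u + Pi.single b 1 + (z + z')) (u + Pi.single b 1) := by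
    intro z z' hz hz' u
    have h1 := hz u
    have h2 := hz' (u + z)
    rw [add_right_comm u z (Pi.single b 1 : ι → ℕ)] at h2
    rw [← add_assoc]
    exact ⟨h1.1.trans h2.1, h2.2.trans h1.2⟩
  intro z
  rw [← Finset.univ_sum_single z]
  refine Finset.sum_induction _ (fun z => ∀ u : ι → ℕ, Reach R (u + Pi.single b 1)
    (u + Pi.single b 1 + z) ∧ Reach R (u + Pi.single b 1 + z) (u + Pi.single b 1)) hadd h0 ?_
  intro c _
  induction z c with
  | zero => simpa using h0
  | succ n ih =>
    rw [Pi.single_add]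
    exact hadd _ _ ih (reach_single hbh hR c)

theorem exists_eq_add_single {ι : Type*} [DecidableEq ι] {b : ι} {u : ι → ℕ} (hu : 1 ≤ u b) :
    ∃ u', u = u' + (Pi.single b 1 : ι → ℕ) := by
  refine ⟨u - (Pi.single b 1 : ι → ℕ), ?_⟩
  ext i
  simp only [Pi.add_apply, Pi.sub_apply, Pi.single_apply]
  grind

/-- Both configurations are connected in either direction to their sum with one of the two tokens at
`b` left out. -/
theorem reach_of_pos {b h : ι} (hbh : h ≠ b) {R : List (Rule ι)} (hR : freeRules b h ⊆ R)
    {u v : ι → ℕ} (hu : 1 ≤ u b) (hv : 1 ≤ v b) : Reach R u v := by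
  obtain ⟨u, rfl⟩ := exists_eq_add_single hu
  obtain ⟨v, rfl⟩ := exists_eq_add_single hv
  have h1 := (reach_add hbh hR v u).1
  have h2 := (reach_add hbh hR u v).2
  rw [show v + Pi.single b 1 + u = u + Pi.single b 1 + v by abel] at h2
  exact h1.trans h2

/-- Once there is a token at `b`, every transition by a rule can be covered on a cycle. -/
theorem exists_cycle_of_reach {b h : ι} (hbh : h ≠ b) {R : List (Rule ι)}
    (hR : freeRules b h ⊆ R) {x u₀ : ι → ℕ} (hx : Reach R x u₀) (hu₀ : 1 ≤ u₀ b)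
    {r : Rule ι} (hr : b ∉ r.zero) {u v : ι → ℕ} (hf : r.Fires u v) :
    ∃ u' v', u ≤ u' ∧ v ≤ v' ∧ r.Fires u' v' ∧ Reach R x u' ∧ Reach R v' x := by
  -- An extra token at `b` does not disable the rule, which does not test `b`, and it makes source
  -- and target accessible to the free rules.
  refine ⟨u + Pi.single b 1, v + Pi.single b 1, le_self_add, le_self_add, ⟨fun i => ?_, ?_⟩,
    hx.trans (reach_of_pos hbh hR hu₀ (by simp)),
    ReflTransGen.trans (reach_of_pos hbh hR (v := x + Pi.single b 1) (by simp) (by simp))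
      (reach_drop hR x)⟩
  · have := hf.1 i
    simp only [Pi.add_apply]
    push_cast
    omega
  · intro i hi
    have : i ≠ b := fun e => hr (e ▸ hi)
    simp [hf.2 i hi, this]

end FreeRules

/-! ## Counter automata as rules -/

section CounterRules

open CounterProgram Instr Function

/-- All registers of the instruction are below `N`. -/
def _root_.CounterProgram.Instr.Bounded (N : ℕ) : Instr → Prop
  | nop => True
  | inc r | dec r | test r => r < N

/-- The change of a register by an instruction. -/
def _root_.CounterProgram.Instr.delta : Instr → ℕ → ℤ
  | inc k, r => if r = k then 1 else 0
  | dec k, r => if r = k then -1 else 0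
  | _, _ => 0

/-- Only finitely many registers occur in an automaton, so finitely many coordinates are enough. -/
theorem exists_bounded {σ : Type*} (E : List (σ × Instr × σ)) : ∃ N, ∀ e ∈ E, e.2.1.Bounded N := by
  have mono : ∀ (i : Instr) {N M : ℕ}, N ≤ M → i.Bounded N → i.Bounded M := by
    intro i N M hNM hi
    cases i <;> simp only [Bounded] at hi ⊢ <;> omega
  induction E with
  | nil => exact ⟨0, by simp⟩
  | cons e E ih =>
    obtain ⟨N, hN⟩ := ih
    obtain ⟨M, hM⟩ : ∃ M, e.2.1.Bounded M := by
      obtain ⟨-, i, -⟩ := e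
      cases i with
      | nop => exact ⟨0, trivial⟩
      | inc r | dec r | test r => exact ⟨r + 1, Nat.lt_succ_self r⟩
    refine ⟨max N M, fun e' he' => ?_⟩
    rcases List.mem_cons.1 he' with rfl | he'
    · exact mono _ (le_max_right _ _) hM
    · exact mono _ (le_max_left _ _) (hN e' he')

variable {N : ℕ} {σ : Type*} [DecidableEq σ]

/-- The register that is tested by an instruction. -/
def _root_.CounterProgram.Instr.tested (N : ℕ) (σ : Type*) : Instr → Option (Fin N ⊕ Option σ)
  | test r => if h : r < N then some (.inl ⟨r, h⟩) else none
  | _ => none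

/-- The rule of an edge. The coordinates are the registers, the states, and one more. -/
def edgeRule (N : ℕ) (e : σ × Instr × σ) : Rule (Fin N ⊕ Option σ) where
  act := Sum.elim (fun r => e.2.1.delta r) fun o =>
    (if o = some e.2.2 then 1 else 0) - (if o = some e.1 then 1 else 0)
  zero := e.2.1.tested N σ

/-- The configuration with the state `q` and the registers `s`. -/
def conf (N : ℕ) (q : σ) (s : Store) : Fin N ⊕ Option σ → ℕ :=
  Sum.elim (fun r => s r) fun o => if o = some q then 1 else 0

theorem fires_edgeRule {p q : σ} {i : Instr} {s t : Store} (h : i.Eff s t) :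
    (edgeRule N (p, i, q)).Fires (conf N p s) (conf N q t) := by
  constructor
  · rintro (r | o)
    · cases i <;> simp only [Eff] at h <;> simp only [conf, edgeRule, delta, Sum.elim_inl]
      · simp [h]
      · subst h; simp only [update_apply]; grind
      · obtain ⟨h, rfl⟩ := h; simp only [update_apply]; grind
      · simp [h.2]
    · simp only [conf, edgeRule, Sum.elim_inr]
      grind
  · intro c hc
    cases i <;> simp only [edgeRule, tested] at hc <;> try simp at hc
    obtain ⟨hr, rfl⟩ := hc
    exact h.1

/-- Because `p ≠ q`, the rule takes a token from `p`, and the only state with a token is `p'`.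
Boundedness ensures that a tested register is among the coordinates. -/
theorem exists_of_fires_edgeRule {p q p' : σ} (hpq : p ≠ q) {i : Instr} (hi : i.Bounded N)
    {s : Store} {v : Fin N ⊕ Option σ → ℕ}
    (h : (edgeRule N (p, i, q)).Fires (conf N p' s) v) :
    p = p' ∧ ∃ t, i.Eff s t ∧ v = conf N q t := by
  obtain ⟨h1, h2⟩ := h
  have hp := h1 (.inr (some p))
  simp only [conf, edgeRule, Sum.elim_inr, Option.some.injEq, if_neg hpq, if_true] at hp
  obtain rfl : p = p' := by
    by_contra hne
    rw [if_neg hne] at hp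
    omega
  refine ⟨rfl, ?_⟩
  have hst : ∀ o, v (.inr o) = conf N q s (.inr o) := by
    intro o
    have := h1 (.inr o)
    simp only [conf, edgeRule, Sum.elim_inr] at this ⊢
    grind
  have hreg : ∀ r : Fin N, (v (.inl r) : ℤ) = s r + i.delta r := fun r => h1 (.inl r)
  have fin : ∀ t : Store, (∀ r : Fin N, v (.inl r) = t r) → v = conf N q t := by
    intro t ht
    ext (r | o)
    · exact ht r
    · exact hst o
  cases i with
  | nop => exact ⟨s, rfl, fin s fun r => by simpa [delta] using hreg r⟩
  | inc k =>
    refine ⟨_, rfl, fin _ fun r => ?_⟩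
    have := hreg r
    simp only [delta] at this
    simp only [update_apply]
    grind
  | dec k =>
    have hk := hreg ⟨k, hi⟩
    simp only [delta, if_true] at hk
    refine ⟨_, ⟨by omega, rfl⟩, fin _ fun r => ?_⟩
    have := hreg r
    simp only [delta] at this
    simp only [update_apply]
    grind
  | test k =>
    have hk : k < N := hi
    refine ⟨s, ⟨?_, rfl⟩, fin s fun r => by simpa [delta] using hreg r⟩
    exact h2 (.inl ⟨k, hk⟩) (by simp [edgeRule, tested, hk])

variable [Fintype σ]

/-- The rules of an automaton, together with the free rules for its end state. -/
noncomputable def automatonRules (N : ℕ) (E : List (σ × Instr × σ)) (b : σ) :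
    List (Rule (Fin N ⊕ Option σ)) :=
  E.map (edgeRule N) ++ freeRules (.inr (some b)) (.inr none)

/-- The first half is the condition under which the ideal expresses the tests; the second allows an
extra token at the end state. -/
theorem automatonRules_zero {E : List (σ × Instr × σ)} {b : σ} {r : Rule (Fin N ⊕ Option σ)}
    (hr : r ∈ automatonRules N E b) {c : Fin N ⊕ Option σ} (hc : c ∈ r.zero) :
    r.act c = 0 ∧ c ≠ .inr (some b) := by
  rcases List.mem_append.1 hr with hr | hr
  · obtain ⟨⟨p, i, q⟩, -, rfl⟩ := List.mem_map.1 hr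
    cases i <;> simp only [edgeRule, tested] at hc <;> try simp at hc
    obtain ⟨hr, rfl⟩ := hc
    simp [edgeRule, delta]
  · simp [zero_of_mem_freeRules hr] at hc

/-- The end state can be covered exactly if it is reachable in the automaton. -/
theorem exists_reach_automatonRules_iff {E : List (σ × Instr × σ)} {a b : σ}
    (hE : ∀ e ∈ E, e.1 ≠ e.2.2) (hN : ∀ e ∈ E, e.2.1.Bounded N) {s : Store} :
    (∃ u, Reach (automatonRules N E b) (conf N a s) u ∧ 1 ≤ u (.inr (some b))) ↔
      ∃ t, ReflTransGen (Step E) (a, s) (b, t) := by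
  constructor
  · rintro ⟨u, hu, hub⟩
    -- Until the end state is reached, configurations encode those of the automaton. They have no
    -- token at the extra coordinate, so the first free rule to fire finds its token at `b`.
    have key : ∀ u, Reach (automatonRules N E b) (conf N a s) u →
        (∃ t, ReflTransGen (Step E) (a, s) (b, t)) ∨
          ∃ q t, u = conf N q t ∧ ReflTransGen (Step E) (a, s) (q, t) := by
      intro u hu
      induction hu with
      | refl => exact .inr ⟨a, s, rfl, .refl⟩
      | @tail u v _ h ih =>
        obtain ⟨r, hr, hf⟩ := h
        rcases ih with ih | ⟨q, t, rfl, ih⟩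
        · exact .inl ih
        rcases List.mem_append.1 hr with hr | hr
        · obtain ⟨⟨p, i, p'⟩, he, rfl⟩ := List.mem_map.1 hr
          obtain ⟨rfl, t', ht', rfl⟩ := exists_of_fires_edgeRule (hE _ he) (hN _ he) hf
          exact .inr ⟨_, _, rfl, ih.tail ⟨i, he, ht'⟩⟩
        · left
          have := pos_of_fires_freeRules (by simp) hr hf
          by_cases hbq : b = q
          · exact ⟨t, hbq ▸ ih⟩
          · simp [conf, hbq] at this
    rcases key u hu with h | ⟨q, t, rfl, h⟩
    · exact h
    · by_cases hbq : b = q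
      · exact ⟨t, hbq ▸ h⟩
      · simp [conf, hbq] at hub
  · rintro ⟨t, ht⟩
    refine ⟨conf N b t, ?_, by simp [conf]⟩
    exact ReflTransGen.lift (fun c : σ × Store => conf N c.1 c.2)
      (fun c c' ⟨i, hi, he⟩ => ⟨_, List.mem_append_left _ (List.mem_map_of_mem hi),
        fires_edgeRule he⟩) _ _ ht

end CounterRules

/-! ## Undecidability -/

open CounterProgram in
/-- For every partial recursive function there are rules such that the function is defined on `m`
exactly if the ideal is adherent, when the coordinate `c` is `m` in the initial configuration. -/
theorem exists_rules_of_partrec {f : ℕ →. ℕ} (hf : Partrec f) :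
    ∃ (d : ℕ) (R : List (Rule (Fin d))) (x : Fin d → ℕ → ℕ),
      (∀ r ∈ R, ∀ i ∈ r.zero, r.act i = 0) ∧ (∀ i, Primrec (x i)) ∧
      ∀ m, (ruleInput R fun i => x i m).IsPositive ↔ (f m).Dom := by
  obtain ⟨P, hP⟩ := exists_prog_of_partrec hf
  obtain ⟨σ, _, _, E, a, b, hE, hEP⟩ := exists_automaton P
  obtain ⟨N, hN⟩ := exists_bounded E
  let ε := Fintype.equivFin (Fin N ⊕ Option σ)
  have hz : ∀ r ∈ (automatonRules N E b).map (Rule.reindex ε), ∀ i ∈ r.zero, r.act i = 0 := by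
    intro r hr i hi
    obtain ⟨r, hr', rfl⟩ := List.mem_map.1 hr
    obtain ⟨j, hj, rfl⟩ := Option.mem_map.1 hi
    simpa [Rule.reindex] using (automatonRules_zero hr' hj).1
  have hfree : freeRules (.inr (some b)) (.inr none) ⊆ automatonRules N E b :=
    List.subset_append_right _ _
  refine ⟨_, (automatonRules N E b).map (Rule.reindex ε),
    fun i m => conf N a (Function.update 0 0 m) (ε.symm i), hz, fun i => ?_, fun m => ?_⟩
  · rcases h : ε.symm i with r | o
    · by_cases h0 : (r : ℕ) = 0
      · simp only [h, conf, Function.update_apply, Sum.elim_inl, h0, if_true]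
        exact Primrec.id
      · simpa [h, conf, Function.update_apply, h0] using Primrec.const 0
    · simpa [h, conf] using Primrec.const _
  · have hiff := exists_reach_automatonRules_iff (a := a) (b := b) hE hN
      (s := Function.update 0 0 m)
    simp only [← hEP, hP] at hiff
    rw [← hiff]
    have hconf : (fun i => conf N a (Function.update 0 0 m) (ε.symm i)) ∘ ε =
        conf N a (Function.update 0 0 m) := by
      ext i; simp
    constructor
    · intro h
      -- This rule just removes a token at `b`; covering the source of its smallest firing means
      -- reaching a token at `b`.
      have hsub : (subRule (.inr (some b)) (.inr none) (.inr none) : Rule (Fin N ⊕ Option σ)) ∈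
          automatonRules N E b := hfree (mem_freeRules.2 (.inr (.inr ⟨_, rfl⟩)))
      obtain ⟨u, hu, hle⟩ := exists_reach_of_isPositive hz h (List.mem_map_of_mem hsub)
        (u := Pi.single (.inr (some b)) 1 ∘ ε.symm) (v := 0)
        ((Rule.fires_reindex ε _).2 ⟨fun i => by simp [subRule, Pi.single_apply],
          by simp [subRule]⟩)
      rw [reach_reindex, hconf] at hu
      exact ⟨_, hu, by simpa using hle (ε (.inr (some b)))⟩
    · rintro ⟨u₀, hu₀, hb⟩
      refine isPositive_of_forall_exists hz fun r hr u v hfire => ?_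
      obtain ⟨r, hr', rfl⟩ := List.mem_map.1 hr
      rw [Rule.fires_reindex] at hfire
      obtain ⟨u', v', h1, h2, h3, h4, h5⟩ := exists_cycle_of_reach (by simp) hfree hu₀ hb
        (fun hc => (automatonRules_zero hr' hc).2 rfl) hfire
      refine ⟨u' ∘ ε.symm, v' ∘ ε.symm, fun i => by simpa using h1 (ε.symm i),
        fun i => by simpa using h2 (ε.symm i), ?_, ?_, ?_⟩
      · rw [Rule.fires_reindex]
        simpa [Function.comp_assoc] using h3
      · rw [reach_reindex, hconf]
        simpa [Function.comp_assoc] using h4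
      · rw [reach_reindex, hconf]
        simpa [Function.comp_assoc] using h5

theorem computable_encode_ruleInput {d : ℕ} (R : List (Rule (Fin d))) {x : Fin d → ℕ → ℕ}
    (hx : ∀ i, Primrec (x i)) :
    Computable fun m => (ruleInput R fun i => x i m).encode := by
  have h1 : Primrec fun m => List.ofFn fun i => x i m := .list_ofFn hx
  have h2 : Primrec fun m => List.ofFn fun i => encodeOmega (toOmega (fun i => x i m) i) :=
    .list_ofFn fun i => (Primrec.option_some.comp (hx i)).of_eq fun m => rfl
  -- The word of the ideal does not depend on the configuration, so `0` can stand for it.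
  let w : List (List TripleCode ⊕ TripleCode) :=
    (ruleIdeal R 0).word.map Atom.encode
  have h3 : Primrec fun m : ℕ => ((d, (R.map Rule.act).map List.ofFn, List.ofFn fun i => x i m,
      List.ofFn fun i => x i m, List.ofFn fun i => encodeOmega (toOmega (fun i => x i m) i), w,
      List.ofFn fun i => encodeOmega (toOmega (fun i => x i m) i)) : AdhCode) :=
    (Primrec.const d).pair ((Primrec.const _).pair (h1.pair (h1.pair
      (h2.pair ((Primrec.const w).pair h2)))))
  exact h3.to_comp

theorem not_adherenceDecidableOn_isSpecial : ¬ AdherenceDecidableOn {p | p.IsSpecial} := by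
  rintro ⟨g, hg, H⟩
  -- The universal function on input `0`: its domain is the set of codes of programs that halt on
  -- `0`.
  have hf : Partrec fun m : ℕ => Nat.Partrec.Code.eval (Denumerable.ofNat _ m) 0 :=
    Nat.Partrec.Code.eval_part.comp (Computable.ofNat _) (Computable.const 0)
  obtain ⟨d, R, x, hR, hx, hdom⟩ := exists_rules_of_partrec hf
  have hspec := fun m => H _ (isSpecial_ruleInput hR fun i => x i m)
  choose b hb hbp using hspec
  have hcomp : Computable b :=
    Partrec.of_eq_tot (hg.comp (computable_encode_ruleInput R hx)) hb
  refine ComputablePred.halting_problem 0 ⟨Classical.decPred _, ?_⟩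
  classical
  refine (hcomp.comp Computable.encode).of_eq fun c => ?_
  have := (hbp (Encodable.encode c)).trans (hdom _)
  rw [Denumerable.ofNat_encode] at this
  rw [Bool.eq_iff_iff, this, decide_eq_true_iff]

end VAS

/-- Adherence membership of prerun ideals is undecidable, already for ideals of the form
`↓x × D^* × ↓x` with `D` a downward-closed set of transitions. -/
theorem mainTheorem4 :
    ¬ VAS.AdherenceDecidableOn Set.univ ∧
    ¬ VAS.AdherenceDecidableOn {p | p.IsSpecial} :=
  ⟨fun ⟨g, hg, H⟩ => VAS.not_adherenceDecidableOn_isSpecial ⟨g, hg, fun p _ => H p trivial⟩,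
    VAS.not_adherenceDecidableOn_isSpecial⟩
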